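/- Let $k$ be an algebraically closed field of any characteristic, let $X$ be a smooth quasiprojective scheme over $k$ (that is, isomorphic over $k$ to a locally closed subscheme of some $\mathbb P^n_k$), let $U\subset X$ be a dense open subset, and let $R\subset X$ be a non-empty subscheme that is finite over $k$. Then there exist a curve $T$ over $k$ (a smooth quasiprojective integral $k$-scheme of dimension $1$), a $k$-point $0\in T$, and a closed subscheme $\mathcal R\subset X\times_k T$ whose projection $\pi\colon\mathcal R\to T$ is finite, flat and surjective, such that, writing $R_t=\pi^{-1}(t)$ for the scheme-theoretic fibre over $t\in T$, the following hold: 1. $R_0=R$ as subschemes of $X$; 2. for every point $t\in T\setminus\{0\}$ (closed or not) the projection $R_t\to X$ has image in $U$; in particular, for every $k$-point $t\neq 0$ of $T$ the subscheme $R_t\subset X$ is contained in $U$. -/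

import Mathlib

open CategoryTheory CategoryTheory.Limits AlgebraicGeometry

universe u

noncomputable section

namespace MovingSchemes

variable (k : Type u) [Field k]

attribute [local instance] MvPolynomial.gradedAlgebra

/-- Projective `n`-space over `k`: the `Proj` of `k[x₀, …, xₙ]` with its standard grading. -/
def ProjSpace (n : ℕ) : Scheme.{u} :=
  Proj (MvPolynomial.homogeneousSubmodule (Fin (n + 1)) k)

/-- The structure morphism of projective `n`-space over `k`. -/
def ProjSpace.toSpec (n : ℕ) : ProjSpace k n ⟶ Spec (.of k) :=
  Proj.toSpecZero (MvPolynomial.homogeneousSubmodule (Fin (n + 1)) k) ≫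
    Spec.map (CommRingCat.ofHom
      (algebraMap k (MvPolynomial.homogeneousSubmodule (Fin (n + 1)) k 0)))

variable {k}

/-- A `k`-scheme is quasiprojective if it is isomorphic over `k` to a locally closed subscheme of
some projective space over `k`. -/
def IsQuasiprojective {X : Scheme.{u}} (f : X ⟶ Spec (.of k)) : Prop :=
  ∃ (n : ℕ) (i : X ⟶ ProjSpace k n), IsImmersion i ∧ i ≫ ProjSpace.toSpec k n = f

/-- A curve over `k`: a smooth quasiprojective integral `k`-scheme of dimension `1`. -/
structure IsCurve {T : Scheme.{u}} (g : T ⟶ Spec (.of k)) : Prop where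
  smooth : Smooth g
  quasiprojective : IsQuasiprojective g
  integral : IsIntegral T
  dim_eq_one : topologicalKrullDim T = 1

/-- The point `t` of the `k`-scheme `T` is a `k`-point: it is the image of a section of the
structure morphism. -/
def IsKPoint {T : Scheme.{u}} (g : T ⟶ Spec (.of k)) (t : T) : Prop :=
  ∃ s : Spec (.of k) ⟶ T, s ≫ g = 𝟙 _ ∧ Set.range s = {t}

/-- A flat family of subschemes of `X` parametrised by `T`: a closed subscheme of `X × T` (product
over `k`) whose projection to `T` is flat and surjective. -/
structure FlatFamily {X T : Scheme.{u}} (f : X ⟶ Spec (.of k)) (g : T ⟶ Spec (.of k)) where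
  /-- The total space of the family. -/
  total : Scheme.{u}
  /-- The embedding of the total space into `X × T`. -/
  incl : total ⟶ pullback f g
  isClosedImmersion : IsClosedImmersion incl
  flat : Flat (incl ≫ pullback.snd f g)
  surjective : Surjective (incl ≫ pullback.snd f g)

namespace FlatFamily

variable {X T : Scheme.{u}} {f : X ⟶ Spec (.of k)} {g : T ⟶ Spec (.of k)}

/-- The projection from the total space to the base `T`. -/
def proj (F : FlatFamily f g) : F.total ⟶ T := F.incl ≫ pullback.snd f g

/-- The projection from the total space to `X`. -/
def toX (F : FlatFamily f g) : F.total ⟶ X := F.incl ≫ pullback.fst f g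

/-- The scheme-theoretic fibre of the family over the point `t`. -/
def fibre (F : FlatFamily f g) (t : T) : Scheme.{u} := F.proj.fiber t

/-- The map to `X` of the fibre over `t`. If `t` is a `k`-point, this is the embedding of the fibre
as a closed subscheme of `X`. -/
def fibreToX (F : FlatFamily f g) (t : T) : F.fibre t ⟶ X := F.proj.fiberι t ≫ F.toX

end FlatFamily

end MovingSchemes

end

noncomputable section

namespace MovingSchemes

open Polynomial TensorProduct

/-! ### Étale lifting, dense opens in quasi-finite algebras, lines in affine space -/

section CommutativeAlgebra

/-! The abstract scheme `R` stays constant and only its embedding moves: the total space is `R × T`,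
so finiteness and flatness over `T` come by base change from `R → Spec k`.

Since `R` is a finite disjoint union of spectra of finite local `k`-algebras `B`, each piece can be
moved separately. A piece lands in a chart étale over affine space. Quasi-finiteness of the chart
gives a polynomial `h ≠ 0` whose non-vanishing forces a point into `U` (`exists_ne_zero_of_dense`),
and some line through the image of the closed point is not contained in `h = 0`. Translating along
this line moves `B` in affine space. To lift the translation to the chart, the chart is pulled back
to the line, giving an étale neighbourhood `N` of the origin and a lift of the closed point. As
`Spec (B ⊗ N)` is a nilpotent thickening of `Spec N`, étaleness extends that lift
(`exists_local_move`).

Neighbourhoods for different pieces have a common refinement, and the maps glue (`exists_move`). The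
resulting `R × N → X × N` is finite, and a monomorphism over the base point; by Nakayama applied to
its self-product it is a monomorphism nearby (`Move.exists_mono_incl`), hence a closed immersion. A
last shrinking makes `N` integral and removes the parameters, other than the base point, where the
family may leave `U` (`EtaleNbhd.exists_shrink`). -/

theorem _root_.Algebra.QuasiFinite.of_etale (R A : Type*) [CommRing R] [CommRing A] [Algebra R A]
    [Algebra.Etale R A] : Algebra.QuasiFinite R A :=
  ⟨fun P _ ↦ Algebra.FormallyUnramified.finite_of_free P.ResidueField (P.Fiber A)⟩

/-- Lifting along a nilpotent thickening for an étale ring map. -/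
theorem exists_lift_of_etale {P A D C : Type*} [CommRing P] [CommRing A] [CommRing D] [CommRing C]
    [Algebra P A] [Algebra.Etale P A] (θ : P →+* D) (ψ : A →+* C) (g : D →+* C)
    (hg : Function.Surjective g) (hnil : IsNilpotent (RingHom.ker g))
    (h : g.comp θ = ψ.comp (algebraMap P A)) :
    ∃ Φ : A →+* D, Φ.comp (algebraMap P A) = θ ∧ g.comp Φ = ψ := by
  let := θ.toAlgebra
  let := (g.comp θ).toAlgebra
  let ψ' : A →ₐ[P] C := ⟨ψ, fun r ↦ (RingHom.congr_fun h r).symm⟩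
  let g' : D →ₐ[P] C := ⟨g, fun r ↦ rfl⟩
  let Φ := Algebra.FormallySmooth.liftOfSurjective ψ' g' hg hnil
  exact ⟨Φ.toRingHom, Φ.comp_algebraMap,
    congrArg AlgHom.toRingHom (Algebra.FormallySmooth.comp_liftOfSurjective ψ' g' hg hnil)⟩

/-- Uniqueness of lifts along a nilpotent thickening for an étale ring map. -/
theorem lift_unique_of_etale {P A D C : Type*} [CommRing P] [CommRing A] [CommRing D] [CommRing C]
    [Algebra P A] [Algebra.Etale P A] (g : D →+* C) (hnil : IsNilpotent (RingHom.ker g))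
    (Φ₁ Φ₂ : A →+* D) (h : Φ₁.comp (algebraMap P A) = Φ₂.comp (algebraMap P A))
    (hg : g.comp Φ₁ = g.comp Φ₂) : Φ₁ = Φ₂ := by
  let := (Φ₁.comp (algebraMap P A)).toAlgebra
  let Φ₁' : A →ₐ[P] D := ⟨Φ₁, fun r ↦ rfl⟩
  let Φ₂' : A →ₐ[P] D := ⟨Φ₂, fun r ↦ (RingHom.congr_fun h r).symm⟩
  exact congrArg AlgHom.toRingHom
    (Algebra.FormallyUnramified.ext' g hnil Φ₁' Φ₂' (RingHom.congr_fun hg))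

/-- Prime avoidance gives `f ∉ p` lying in all other minimal primes. The open set `U` meets `D(f)`
in some `r`; the only minimal prime that can lie below `r` is `p`, and open sets are stable under
generization. -/
theorem _root_.PrimeSpectrum.mem_of_dense_of_mem_minimalPrimes {A : Type*} [CommRing A]
    [IsNoetherianRing A] {U : Set (PrimeSpectrum A)} (hU : IsOpen U) (hd : Dense U)
    (p : PrimeSpectrum A) (hp : p.asIdeal ∈ minimalPrimes A) : p ∈ U := by
  classical
  have hfin := minimalPrimes.finite_of_isNoetherianRing A
  let s := hfin.toFinset.erase p.asIdeal
  have hs : ¬ s.inf id ≤ p.asIdeal := by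
    rw [p.isPrime.inf_le']
    rintro ⟨J, hJ, hle⟩
    obtain ⟨hJ₁, hJ₂⟩ := Finset.mem_erase.mp hJ
    exact hJ₁ (hle.antisymm (hp.2 ((hfin.mem_toFinset.mp hJ₂).1) hle))
  obtain ⟨f, hf, hfp⟩ := SetLike.not_le_iff_exists.mp hs
  obtain ⟨r, hr, hrU⟩ := hd.inter_open_nonempty _ (PrimeSpectrum.isOpen_basicOpen (a := f)) ⟨p, hfp⟩
  obtain ⟨q, hq, hqr⟩ := Ideal.exists_minimalPrimes_le (bot_le : (⊥ : Ideal A) ≤ r.asIdeal)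
  have hqp : q = p.asIdeal := by
    by_contra hne
    have : s.inf id ≤ q := Finset.inf_le (f := id)
      (Finset.mem_erase.mpr ⟨hne, hfin.mem_toFinset.mpr hq⟩)
    exact hr (hqr (this hf))
  have : p ⤳ r := by
    rw [← PrimeSpectrum.le_iff_specializes, ← PrimeSpectrum.asIdeal_le_asIdeal, ← hqp]
    exact hqr
  exact this.mem_open hU hrU

/-- For a quasi-finite algebra over a domain, a dense open subset of the spectrum contains the
preimage of a non-empty basic open subset of the base. -/
theorem exists_ne_zero_of_dense {P A : Type*} [CommRing P] [IsDomain P] [CommRing A]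
    [IsNoetherianRing A] [Algebra P A] [Algebra.QuasiFinite P A] {U : Set (PrimeSpectrum A)}
    (hU : IsOpen U) (hd : Dense U) :
    ∃ h : P, h ≠ 0 ∧ ∀ p : PrimeSpectrum A, algebraMap P A h ∉ p.asIdeal → p ∈ U := by
  obtain ⟨I, hI⟩ := (PrimeSpectrum.isClosed_iff_zeroLocus_ideal _).mp hU.isClosed_compl
  suffices I.comap (algebraMap P A) ≠ ⊥ by
    obtain ⟨h, hh, h0⟩ := Submodule.exists_mem_ne_zero_of_ne_bot this
    refine ⟨h, h0, fun p hp ↦ ?_⟩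
    by_contra hpU
    have : p ∈ PrimeSpectrum.zeroLocus (I : Set A) := hI ▸ hpU
    exact hp (this hh)
  -- Otherwise some minimal prime `p` of `I` contracts to zero. Incomparability in fibres makes `p`
  -- minimal in `A`, so density puts it in `U`, although it contains `I`.
  intro hbot
  obtain ⟨p, hp, hpc⟩ := Ideal.exists_minimalPrimes_comap_eq (I := I) (algebraMap P A) ⊥
    (by rw [hbot]; simp [IsDomain.minimalPrimes_eq_singleton_bot])
  have hpp : p.IsPrime := hp.1.1
  have hmin : p ∈ minimalPrimes A := by
    refine ⟨⟨hpp, bot_le⟩, fun q ⟨hq, _⟩ hqp ↦ ?_⟩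
    have := hq
    refine (Algebra.QuasiFinite.eq_of_le_of_under_eq (R := P) q p hqp ?_).ge
    have h1 : p.under P = ⊥ := hpc
    rw [h1, eq_bot_iff, ← h1]
    exact Ideal.comap_mono hqp
  have h1 := PrimeSpectrum.mem_of_dense_of_mem_minimalPrimes hU hd ⟨p, hpp⟩ hmin
  have h2 : (⟨p, hpp⟩ : PrimeSpectrum A) ∈ Uᶜ := by
    rw [hI]
    exact hp.1.2
  exact h2 h1

/-- A non-zero polynomial does not vanish identically on some line through a given point. -/
theorem exists_line_ne_zero {k : Type*} [Field k] [Infinite k] {n : ℕ}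
    (h : MvPolynomial (Fin n) k) (h0 : h ≠ 0) (c : Fin n → k) :
    ∃ v : Fin n → k, MvPolynomial.aeval (fun j ↦ (C (c j) + C (v j) * X : k[X])) h ≠ 0 := by
  obtain ⟨w, hw⟩ : ∃ w, MvPolynomial.eval w h ≠ 0 := by
    by_contra! H
    exact h0 (MvPolynomial.funext fun x ↦ by simp [H x])
  -- The line from `c` in this direction passes through `w` at parameter `1`.
  refine ⟨w - c, fun H ↦ hw ?_⟩
  have := congrArg (Polynomial.aeval (1 : k)) H
  have hw' : (fun j ↦ Polynomial.aeval (1 : k) (C (c j) + C ((w - c) j) * X)) = w := by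
    ext j
    simp
  rwa [map_zero, ← AlgHom.comp_apply, MvPolynomial.comp_aeval, hw',
    MvPolynomial.aeval_eq_eval] at this

end CommutativeAlgebra

/-! ### Étale neighbourhoods of the origin and their refinements -/

/-- An étale neighbourhood of the origin of the affine line over `k`. -/
structure EtaleNbhd (k : Type u) [Field k] where
  /-- The coordinate ring. -/
  ring : Type u
  [commRing : CommRing ring]
  [algebra : Algebra k ring]
  [polyAlgebra : Algebra k[X] ring]
  [isScalarTower : IsScalarTower k k[X] ring]
  [etale : Algebra.Etale k[X] ring]
  /-- The evaluation at the base point. -/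
  aug : ring →ₐ[k] k
  aug_X : aug (algebraMap k[X] ring X) = 0

namespace EtaleNbhd

attribute [instance] commRing algebra polyAlgebra isScalarTower etale

variable {k : Type u} [Field k]

/-- A morphism of étale neighbourhoods `N' ⟶ N`, given by a map of coordinate rings. -/
structure Hom (N N' : EtaleNbhd k) where
  /-- The map of coordinate rings. -/
  toAlgHom : N.ring →ₐ[k[X]] N'.ring
  aug_comp (x : N.ring) : N'.aug (toAlgHom x) = N.aug x

lemma aug_algebraMap (N : EtaleNbhd k) (p : k[X]) :
    N.aug (algebraMap k[X] N.ring p) = p.eval 0 := by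
  have : N.aug.comp (IsScalarTower.toAlgHom k k[X] N.ring) = Polynomial.aeval (0 : k) := by
    ext
    simp [N.aug_X]
  simpa [Polynomial.coe_aeval_eq_eval] using AlgHom.congr_fun this p

/-- The affine line itself. -/
def affineLine (k : Type u) [Field k] : EtaleNbhd k where
  ring := k[X]
  aug := Polynomial.aeval 0
  aug_X := by simp

/-- The tensor product of two augmentations. -/
def prodAug (N N' : EtaleNbhd k) : N.ring ⊗[k[X]] N'.ring →+* k :=
  letI := (N.aug.toRingHom.comp (algebraMap k[X] N.ring)).toAlgebra
  (Algebra.TensorProduct.lift (R := k[X]) (S := k[X]) (C := k) ⟨N.aug.toRingHom, fun _ ↦ rfl⟩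
    ⟨N'.aug.toRingHom, fun x ↦ (N'.aug_algebraMap x).trans (N.aug_algebraMap x).symm⟩
    fun _ _ ↦ .all _ _).toRingHom

lemma prodAug_tmul (N N' : EtaleNbhd k) (x : N.ring) (y : N'.ring) :
    prodAug N N' (x ⊗ₜ y) = N.aug x * N'.aug y := by
  let := (N.aug.toRingHom.comp (algebraMap k[X] N.ring)).toAlgebra
  exact Algebra.TensorProduct.lift_tmul (R := k[X]) (S := k[X]) (C := k)
    ⟨N.aug.toRingHom, fun _ ↦ rfl⟩
    ⟨N'.aug.toRingHom, fun x ↦ (N'.aug_algebraMap x).trans (N.aug_algebraMap x).symm⟩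
    (fun _ _ ↦ .all _ _) x y

/-- The fibre product of two étale neighbourhoods over the affine line. -/
def prod (N N' : EtaleNbhd k) : EtaleNbhd k where
  ring := N.ring ⊗[k[X]] N'.ring
  etale := Algebra.Etale.comp k[X] N.ring _
  aug :=
    { prodAug N N' with
      commutes' r := (prodAug_tmul N N' (algebraMap k N.ring r) 1).trans (by simp) }
  aug_X := (prodAug_tmul N N' (algebraMap k[X] N.ring X) 1).trans (by simp [aug_algebraMap])

/-- The first projection from a fibre product. -/
def prodLeft (N N' : EtaleNbhd k) : N.Hom (N.prod N') where
  toAlgHom := Algebra.TensorProduct.includeLeft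
  aug_comp x := (prodAug_tmul N N' x 1).trans (by simp)

/-- The second projection from a fibre product. -/
def prodRight (N N' : EtaleNbhd k) : N'.Hom (N.prod N') where
  toAlgHom := Algebra.TensorProduct.includeRight
  aug_comp x := (prodAug_tmul N N' 1 x).trans (by simp)

lemma Hom.toAlgHom_algebraMap {N N' : EtaleNbhd k} (a : N.Hom N') (r : k) :
    a.toAlgHom (algebraMap k N.ring r) = algebraMap k N'.ring r := by
  rw [IsScalarTower.algebraMap_apply k k[X] N.ring, AlgHom.commutes,
    ← IsScalarTower.algebraMap_apply]

/-- The composition of morphisms of étale neighbourhoods. -/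
def Hom.comp {N₁ N₂ N₃ : EtaleNbhd k} (b : N₂.Hom N₃) (a : N₁.Hom N₂) : N₁.Hom N₃ where
  toAlgHom := b.toAlgHom.comp a.toAlgHom
  aug_comp x := by simp [a.aug_comp, b.aug_comp]

/-- Finitely many étale neighbourhoods have a common refinement. -/
lemma exists_refinement {ι : Type*} [Finite ι] (N : ι → EtaleNbhd k) :
    ∃ N' : EtaleNbhd k, ∀ i, Nonempty ((N i).Hom N') := by
  classical
  cases nonempty_fintype ι
  suffices ∀ s : Finset ι, ∃ N' : EtaleNbhd k, ∀ i ∈ s, Nonempty ((N i).Hom N') by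
    obtain ⟨N', h⟩ := this Finset.univ
    exact ⟨N', fun i ↦ h i (Finset.mem_univ i)⟩
  intro s
  induction s using Finset.induction_on with
  | empty => exact ⟨affineLine k, by simp⟩
  | insert i s hi ih =>
    obtain ⟨N', h⟩ := ih
    refine ⟨(N i).prod N', fun j hj ↦ ?_⟩
    obtain rfl | hj := Finset.mem_insert.mp hj
    · exact ⟨prodLeft _ _⟩
    · obtain ⟨a⟩ := h j hj
      exact ⟨(prodRight _ _).comp a⟩

end EtaleNbhd

/-! ### Moving a finite local scheme in an étale chart -/

/-- The augmentation of a finite local algebra over an algebraically closed field. -/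
lemma exists_augmentation {k B : Type*} [Field k] [IsAlgClosed k] [CommRing B] [IsLocalRing B]
    [Algebra k B] [Module.Finite k B] :
    ∃ π : B →ₐ[k] k, IsNilpotent (RingHom.ker π) := by
  have : Module.Finite k (IsLocalRing.ResidueField B) :=
    .of_surjective (IsScalarTower.toAlgHom k B _).toLinearMap IsLocalRing.residue_surjective
  let e : k ≃ₐ[k] IsLocalRing.ResidueField B :=
    AlgEquiv.ofBijective (Algebra.ofId _ _) IsAlgClosed.algebraMap_bijective_of_isIntegral
  let π : B →ₐ[k] k := e.symm.toAlgHom.comp (IsScalarTower.toAlgHom k B _)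
  have hπ : Function.Surjective π := fun x ↦ ⟨algebraMap k B x, by simp⟩
  have : IsArtinianRing B := .of_finite k B
  refine ⟨π, ?_⟩
  have := IsLocalRing.ker_eq_maximalIdeal π.toRingHom hπ
  have h2 := (isArtinianRing_iff_isNilpotent_maximalIdeal B).mp ‹_›
  rw [← this] at h2
  exact h2

/-- The pullback of an étale algebra, with compatible points. -/
lemma exists_etale_pullback {P S A K : Type u} [CommRing P] [CommRing S] [CommRing A] [CommRing K]
    [Algebra P A] [Algebra.Etale P A] (γ : P →+* S) (ψ : A →+* K) (e : S →+* K)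
    (h : ∀ p, ψ (algebraMap P A p) = e (γ p)) :
    ∃ (R : Type u) (_ : CommRing R) (_ : Algebra S R) (_ : Algebra.Etale S R) (ι : A →+* R)
      (ε : R →+* K), (∀ p, ι (algebraMap P A p) = algebraMap S R (γ p)) ∧
        (∀ s, ε (algebraMap S R s) = e s) ∧ ∀ a, ε (ι a) = ψ a := by
  let := γ.toAlgebra
  let := (e.comp γ).toAlgebra
  let ε : S ⊗[P] A →ₐ[P] K := Algebra.TensorProduct.lift (R := P) (S := P) ⟨e, fun _ ↦ rfl⟩
    ⟨ψ, h⟩ fun _ _ ↦ .all _ _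
  have hε (x : S) (y : A) : ε (x ⊗ₜ y) = e x * ψ y := Algebra.TensorProduct.lift_tmul ..
  exact ⟨S ⊗[P] A, inferInstance, inferInstance, inferInstance,
    (Algebra.TensorProduct.includeRight : A →ₐ[P] S ⊗[P] A).toRingHom, ε.toRingHom,
    fun p ↦ AlgHom.commutes (Algebra.TensorProduct.includeRight : A →ₐ[P] S ⊗[P] A) p,
    fun s ↦ (hε s 1).trans (by simp), fun a ↦ (hε 1 a).trans (by simp)⟩

/-- The pullback of an étale algebra along a map to the affine line, with a given base point. -/
lemma exists_etaleNbhd_pullback {k P A : Type u} [Field k] [CommRing P] [CommRing A] [Algebra P A]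
    [Algebra.Etale P A] (γ : P →+* k[X]) (ψ : A →+* k)
    (h : ∀ p, ψ (algebraMap P A p) = (γ p).eval 0) :
    ∃ (N : EtaleNbhd k) (ι : A →+* N.ring),
      (∀ p, ι (algebraMap P A p) = algebraMap k[X] N.ring (γ p)) ∧ ∀ a, N.aug (ι a) = ψ a := by
  obtain ⟨R, _, _, _, ι, ε, h1, h2, h3⟩ := exists_etale_pullback γ ψ (evalRingHom 0) h
  let := ((algebraMap k[X] R).comp (algebraMap k k[X])).toAlgebra
  have : IsScalarTower k k[X] R := .of_algebraMap_eq' rfl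
  exact ⟨⟨R, { ε with commutes' := fun r ↦ (h2 (C r)).trans (by simp) }, (h2 X).trans (by simp)⟩,
    ι, h1, h3⟩

/-- Moving a finite local scheme along an étale neighbourhood of the origin of a line: the case of
an affine target that is étale over an affine space. -/
theorem exists_local_move {k A B : Type u} [Field k] [IsAlgClosed k] [CommRing A] {n : ℕ}
    [Algebra (MvPolynomial (Fin n) k) A] [Algebra.Etale (MvPolynomial (Fin n) k) A]
    [CommRing B] [IsLocalRing B] [Algebra k B] [Module.Finite k B] (φ : A →+* B)
    (hφ : ∀ r, φ (algebraMap (MvPolynomial (Fin n) k) A (MvPolynomial.C r)) = algebraMap k B r)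
    {U : Set (PrimeSpectrum A)} (hU : IsOpen U) (hd : Dense U) :
    ∃ (N : EtaleNbhd k) (Φ : A →+* B ⊗[k] N.ring) (q : k[X]), q ≠ 0 ∧
      (∀ r, Φ (algebraMap (MvPolynomial (Fin n) k) A (MvPolynomial.C r)) = algebraMap k _ r) ∧
      ((Algebra.TensorProduct.lift (AlgHom.id k B) ((Algebra.ofId k B).comp N.aug)
        fun _ _ ↦ .all _ _ : B ⊗[k] N.ring →ₐ[k] B) : B ⊗[k] N.ring →+* B).comp Φ = φ ∧
      ∀ p : PrimeSpectrum (B ⊗[k] N.ring),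
        (1 ⊗ₜ algebraMap k[X] N.ring q : B ⊗[k] N.ring) ∉ p.asIdeal →
          PrimeSpectrum.comap Φ p ∈ U := by
  have := Algebra.QuasiFinite.of_etale (MvPolynomial (Fin n) k) A
  have : IsNoetherianRing A := Algebra.FiniteType.isNoetherianRing (MvPolynomial (Fin n) k) A
  have : Infinite k := IsAlgClosed.instInfinite
  obtain ⟨h, h0, hh⟩ := exists_ne_zero_of_dense (P := MvPolynomial (Fin n) k) hU hd
  obtain ⟨π, hπ⟩ := exists_augmentation (k := k) (B := B)
  let c (j : Fin n) : k := π (φ (algebraMap (MvPolynomial (Fin n) k) A (MvPolynomial.X j)))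
  obtain ⟨v, hv⟩ := exists_line_ne_zero h h0 c
  let γ : MvPolynomial (Fin n) k →ₐ[k] k[X] := MvPolynomial.aeval fun j ↦ C (c j) + C (v j) * X
  -- The base point of `N` is the pair formed by the image of the closed point of `Spec B` in the
  -- chart and the origin of the line.
  obtain ⟨N, ι, hι, haug⟩ := exists_etaleNbhd_pullback γ.toRingHom (π.toRingHom.comp φ) fun p ↦ by
    have : ((π.toRingHom.comp φ).comp (algebraMap (MvPolynomial (Fin n) k) A)) =
        (evalRingHom 0).comp γ.toRingHom := by
      ext
      · simp [hφ]
      · simp [γ, c]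
    exact RingHom.congr_fun this p
  -- Reduction modulo the maximal ideal of `B`; its kernel is nilpotent because that ideal is.
  let g : (B ⊗[k] N.ring) →ₐ[k] N.ring := (Algebra.TensorProduct.lid k N.ring).toAlgHom.comp
    (Algebra.TensorProduct.map π (AlgHom.id k N.ring))
  have hg (b : B) (x : N.ring) : g (b ⊗ₜ x) = π b • x := by simp [g]
  have hgsurj : Function.Surjective g := fun x ↦ ⟨1 ⊗ₜ x, by simp [hg]⟩
  have hgnil : IsNilpotent (RingHom.ker g) := by
    have hker : RingHom.ker g = RingHom.ker (Algebra.TensorProduct.map π (AlgHom.id k N.ring)) := by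
      ext x
      simp [g, RingHom.mem_ker]
    have hπs : Function.Surjective π := fun x ↦ ⟨algebraMap k B x, by simp⟩
    obtain ⟨m, hm⟩ := hπ
    refine ⟨m, ?_⟩
    rw [hker, Algebra.TensorProduct.rTensor_ker _ hπs, ← Ideal.map_pow, hm]
    exact Ideal.map_bot
  -- The translate of `Spec B` in affine space by `t • v`, where `t` is the coordinate of the line.
  let θ : MvPolynomial (Fin n) k →+* B ⊗[k] N.ring :=
    MvPolynomial.eval₂Hom (algebraMap k (B ⊗[k] N.ring)) fun j ↦
      φ (algebraMap (MvPolynomial (Fin n) k) A (MvPolynomial.X j)) ⊗ₜ 1 +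
        v j • (1 ⊗ₜ algebraMap k[X] N.ring X)
  have hC (r : k) : algebraMap k[X] N.ring (C r) = algebraMap k N.ring r :=
    (IsScalarTower.algebraMap_apply k k[X] N.ring r).symm
  have hθ : (g : B ⊗[k] N.ring →+* N.ring).comp θ =
      ι.comp (algebraMap (MvPolynomial (Fin n) k) A) := by
    ext j
    · simp [θ, hι, hC]
    · simp [θ, hι, hg, γ, c, hC, Algebra.smul_def]
  obtain ⟨Φ, hΦθ, hΦι⟩ := exists_lift_of_etale θ ι (g : B ⊗[k] N.ring →+* N.ring) hgsurj hgnil hθ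
  refine ⟨N, Φ, γ h, hv, fun r ↦ ?_, ?_, fun p hp ↦ hh _ fun hmem ↦ hp ?_⟩
  · rw [← RingHom.comp_apply, hΦθ]
    simp [θ]
  -- At `t = 0` the lift and `φ` agree on affine space and modulo the maximal ideal of `B`, so they
  -- agree by uniqueness of étale lifts.
  · refine lift_unique_of_etale (P := MvPolynomial (Fin n) k) (π : B →+* k) hπ _ _ ?_ ?_
    · rw [RingHom.comp_assoc, hΦθ]
      ext j
      · simp [θ, hφ]
      · simp [θ, N.aug_X]
    · have hcomp : π.comp (Algebra.TensorProduct.lift (AlgHom.id k B)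
          ((Algebra.ofId k B).comp N.aug) fun _ _ ↦ .all _ _) = N.aug.comp g := by
        ext <;> simp [hg]
      ext a
      have h1 := AlgHom.congr_fun hcomp (Φ a)
      have h2 := RingHom.congr_fun hΦι a
      simp only [AlgHom.comp_apply, RingHom.comp_apply, RingHom.coe_coe] at h1 h2 ⊢
      rw [h1, h2, haug]
      rfl
  -- The translate of `h` and its restriction to the line differ by a nilpotent, so they vanish at
  -- the same primes.
  · have h1 : g (θ h) = g (1 ⊗ₜ algebraMap k[X] N.ring (γ h)) := by
      rw [hg, map_one, one_smul]
      exact (RingHom.congr_fun hθ h).trans (hι h)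
    obtain ⟨m, hm⟩ := hgnil
    have h2 : θ h - 1 ⊗ₜ algebraMap k[X] N.ring (γ h) ∈ RingHom.ker g := by
      rw [RingHom.mem_ker, map_sub, h1, sub_self]
    have h3 : θ h - 1 ⊗ₜ algebraMap k[X] N.ring (γ h) ∈ p.asIdeal := by
      refine p.isPrime.mem_of_pow_mem m ?_
      have h4 := Ideal.pow_mem_pow h2 m
      rw [hm] at h4
      rw [Ideal.mem_bot.mp h4]
      exact zero_mem _
    have h4 : θ h ∈ p.asIdeal := by
      rw [← hΦθ]
      exact hmem
    simpa using sub_mem h4 h3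

/-! ### Spreading out integrality and reducedness from a prime -/

section CommutativeAlgebra

/-- A Noetherian local ring whose maximal ideal is generated by a regular element is a domain. -/
theorem _root_.IsLocalRing.isDomain_of_maximalIdeal_eq_span {L : Type*} [CommRing L] [IsLocalRing L]
    [IsNoetherianRing L] (s : L) (hs : IsLocalRing.maximalIdeal L = Ideal.span {s})
    (hreg : s ∈ nonZeroDivisors L) : IsDomain L := by
  -- By Krull's intersection theorem a nonzero `x` has a finite `s`-adic order, and the cofactor is
  -- then a unit.
  have key (x : L) (hx : x ≠ 0) : ∃ (n : ℕ) (u : L), IsUnit u ∧ x = s ^ n * u := by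
    classical
    have hex : ∃ n, x ∉ IsLocalRing.maximalIdeal L ^ n := by
      by_contra! H
      have := Ideal.iInf_pow_eq_bot_of_isLocalRing (IsLocalRing.maximalIdeal L)
        Ideal.IsPrime.ne_top'
      exact hx (Ideal.mem_bot.mp (this ▸ (Submodule.mem_iInf _).mpr H))
    obtain ⟨n, hn⟩ : ∃ n, Nat.find hex = n + 1 := by
      refine Nat.exists_eq_succ_of_ne_zero fun h0 ↦ ?_
      have := Nat.find_spec hex
      rw [h0] at this
      simp at this
    have h1 : x ∈ IsLocalRing.maximalIdeal L ^ n := by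
      by_contra h
      exact Nat.find_min hex (by omega) h
    have h2 : x ∉ IsLocalRing.maximalIdeal L ^ (n + 1) := hn ▸ Nat.find_spec hex
    rw [hs, Ideal.span_singleton_pow, Ideal.mem_span_singleton'] at h1 h2
    obtain ⟨u, hu⟩ := h1
    refine ⟨n, u, ?_, by rw [← hu, mul_comm]⟩
    by_contra hnu
    have : u ∈ IsLocalRing.maximalIdeal L := hnu
    rw [hs, Ideal.mem_span_singleton'] at this
    obtain ⟨w, rfl⟩ := this
    exact h2 ⟨w, by rw [← hu]; ring⟩
  have : NoZeroDivisors L := by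
    refine ⟨fun {x y} hxy ↦ ?_⟩
    by_contra! H
    obtain ⟨n, u, hu, rfl⟩ := key x H.1
    obtain ⟨m, w, hw, rfl⟩ := key y H.2
    have h1 : s ^ (n + m) * (u * w) = 0 := by rw [← hxy]; ring
    rw [(hu.mul hw).mul_left_eq_zero] at h1
    exact nonZeroDivisors.ne_zero (pow_mem hreg (n + m)) h1
  exact NoZeroDivisors.to_isDomain L

/-- A Noetherian ring that is a domain at a prime is a domain near that prime. -/
theorem exists_notMem_forall_isDomain {C : Type*} [CommRing C] [IsNoetherianRing C] (m : Ideal C)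
    [m.IsPrime] [IsDomain (Localization.AtPrime m)] :
    ∃ f ∉ m, ∀ g ∉ m, f ∣ g → IsDomain (Localization.Away g) := by
  classical
  obtain ⟨t, ht⟩ := (IsNoetherian.noetherian (RingHom.ker
    (algebraMap C (Localization.AtPrime m))) : (RingHom.ker _ : Ideal C).FG)
  have h (x : C) (hx : x ∈ t) : ∃ f ∉ m, f * x = 0 := by
    have : algebraMap C (Localization.AtPrime m) x = 0 := by
      rw [← RingHom.mem_ker, ← ht]
      exact Ideal.subset_span hx
    obtain ⟨f, hf⟩ := (IsLocalization.map_eq_zero_iff m.primeCompl _ _).mp this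
    exact ⟨f, f.2, hf⟩
  choose! F hF hFx using h
  -- The product kills every generator of the kernel of localization. So does each multiple `g`,
  -- hence inverting `g` gives a subring of the local ring.
  refine ⟨∏ x ∈ t, F x, ?_, fun g hg hfg ↦ ?_⟩
  · exact fun hmem ↦ by
      obtain ⟨x, hx, hxm⟩ := Ideal.IsPrime.prod_mem_iff.mp hmem
      exact hF x hx hxm
  have hker (x : C) (hx : algebraMap C (Localization.AtPrime m) x = 0) : g * x = 0 := by
    have hx' : x ∈ Submodule.span C (t : Set C) := ht ▸ hx
    refine Submodule.mem_annihilator.mp ?_ x hx'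
    rw [Submodule.mem_annihilator_span]
    rintro ⟨y, hy⟩
    obtain ⟨c, hc⟩ := (Finset.dvd_prod_of_mem F hy).trans hfg
    rw [smul_eq_mul, hc, mul_right_comm, hFx y hy, zero_mul]
  have hu (y : Submonoid.powers g) : IsUnit (algebraMap C (Localization.AtPrime m) y) := by
    obtain ⟨_, n, rfl⟩ := y
    exact IsLocalization.map_units _ (⟨g ^ n, m.primeCompl.pow_mem hg n⟩ : m.primeCompl)
  refine Function.Injective.isDomain (IsLocalization.lift (S := Localization.Away g) hu) ?_
  rw [IsLocalization.lift_injective_iff]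
  refine fun x y ↦ ⟨fun hxy ↦ ?_, fun hxy ↦ ?_⟩
  · rw [← IsLocalization.lift_eq (S := Localization.Away g) hu,
      ← IsLocalization.lift_eq (S := Localization.Away g) hu, hxy]
  · rw [← sub_eq_zero, ← map_sub] at hxy ⊢
    rw [IsLocalization.map_eq_zero_iff (Submonoid.powers g)]
    exact ⟨⟨g, Submonoid.mem_powers g⟩, hker _ hxy⟩

/-- A reduced quotient of a Noetherian ring by an ideal `I`, at a prime minimal over `I`. -/
theorem exists_notMem_mul_mem_of_isRadical {C : Type*} [CommRing C] [IsNoetherianRing C]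
    {I : Ideal C} (hI : I.IsRadical) (m : Ideal C) (hm : m ∈ I.minimalPrimes) :
    ∃ f ∉ m, ∀ x ∈ m, f * x ∈ I := by
  classical
  have hfin := I.finite_minimalPrimes_of_isNoetherianRing C
  have hmp : m.IsPrime := hm.1.1
  let s := hfin.toFinset.erase m
  have hs : ¬ s.inf id ≤ m := by
    rw [hmp.inf_le']
    rintro ⟨J, hJ, hle⟩
    obtain ⟨hJ₁, hJ₂⟩ := Finset.mem_erase.mp hJ
    exact hJ₁ (hle.antisymm (hm.2 ((hfin.mem_toFinset.mp hJ₂).1) hle))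
  obtain ⟨f, hf, hfm⟩ := SetLike.not_le_iff_exists.mp hs
  -- The element `f` lies in every minimal prime of `I` other than `m`, so `f * x` lies in all of
  -- them, and their intersection is the radical ideal `I`.
  refine ⟨f, hfm, fun x hx ↦ ?_⟩
  rw [← hI.radical, ← Ideal.sInf_minimalPrimes, Ideal.mem_sInf]
  intro J hJ
  by_cases hJm : J = m
  · exact J.mul_mem_left _ (hJm ▸ hx)
  · refine J.mul_mem_right _ ?_
    have : s.inf id ≤ J := Finset.inf_le (f := id)
      (Finset.mem_erase.mpr ⟨hJm, hfin.mem_toFinset.mpr hJ⟩)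
    exact this hf

end CommutativeAlgebra

/-! ### Local structure and shrinking of étale neighbourhoods -/

namespace EtaleNbhd

variable {k : Type u} [Field k] (N : EtaleNbhd k)

instance : Module.Flat k[X] N.ring := Algebra.Smooth.flat _ _

instance : Algebra.QuasiFinite k[X] N.ring := .of_etale _ _

instance : IsNoetherianRing N.ring := Algebra.FiniteType.isNoetherianRing k[X] _

instance : Algebra.FinitePresentation k N.ring := .trans k k[X] N.ring

lemma aug_surjective : Function.Surjective N.aug := fun x ↦ ⟨algebraMap k _ x, by simp⟩

instance : Nontrivial N.ring := N.aug.toRingHom.domain_nontrivial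

/-- The maximal ideal of the base point. -/
abbrev maxIdeal : Ideal N.ring := RingHom.ker N.aug

instance : N.maxIdeal.IsMaximal := RingHom.ker_isMaximal_of_surjective _ N.aug_surjective

lemma algebraMap_X_mem_nonZeroDivisors (S : Type*) [CommRing S] [Algebra k[X] S]
    [Module.Flat k[X] S] : algebraMap k[X] S X ∈ nonZeroDivisors S := by
  have h : IsSMulRegular k[X] (X : k[X]) := fun a b h ↦ mul_left_cancel₀ X_ne_zero h
  refine mem_nonZeroDivisors_iff_right.mpr fun y hy ↦ (h.of_flat (S := S)) ?_
  simpa [mul_comm] using hy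

/-- Any prime between `(X)` and the maximal ideal contracts to the maximal ideal `(X)` of `k[X]`,
and a quasi-finite fibre has no proper inclusions of primes. -/
lemma maxIdeal_mem_minimalPrimes :
    N.maxIdeal ∈ (Ideal.span {algebraMap k[X] N.ring X}).minimalPrimes := by
  refine ⟨⟨inferInstance, (Ideal.span_singleton_le_iff_mem _).mpr N.aug_X⟩, ?_⟩
  rintro p ⟨hp, hle⟩ hpm
  refine (Algebra.QuasiFinite.eq_of_le_of_under_eq (R := k[X]) p _ hpm ?_).ge
  have hX : (Ideal.span {(X : k[X])}).IsMaximal :=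
    PrincipalIdealRing.isMaximal_of_irreducible Polynomial.irreducible_X
  have hXp : Ideal.span {(X : k[X])} ≤ p.under k[X] := by
    rw [Ideal.span_singleton_le_iff_mem]
    exact hle (Ideal.mem_span_singleton_self _)
  have := hX.eq_of_le (Ideal.IsPrime.ne_top inferInstance) hXp
  refine (hX.eq_of_le (Ideal.IsPrime.ne_top inferInstance) hXp).symm.trans
    (hX.eq_of_le (Ideal.IsPrime.ne_top inferInstance) (hXp.trans (Ideal.comap_mono hpm)))

/-- The fibre over the origin is reduced because the algebra is unramified. Hence `X` generates the
maximal ideal of the base point once `f` is inverted. -/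
lemma exists_mul_mem_span :
    ∃ f ∉ N.maxIdeal, ∀ x ∈ N.maxIdeal, f * x ∈ Ideal.span {algebraMap k[X] N.ring X} := by
  refine exists_notMem_mul_mem_of_isRadical ?_ _ N.maxIdeal_mem_minimalPrimes
  have hX : (Ideal.span {(X : k[X])}).IsMaximal :=
    PrincipalIdealRing.isMaximal_of_irreducible Polynomial.irreducible_X
  have := Algebra.FormallyUnramified.isRadical_map_isMaximal (A := k[X]) N.ring (Ideal.span {(X : k[X])})
  rwa [Ideal.map_span, Set.image_singleton] at this

/-- The coordinate `X` generates the maximal ideal of this local ring and is regular by flatness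
over `k[X]`. -/
instance : IsDomain (Localization.AtPrime N.maxIdeal) := by
  refine IsLocalRing.isDomain_of_maximalIdeal_eq_span
    (algebraMap k[X] (Localization.AtPrime N.maxIdeal) X) ?_ ?_
  · rw [← Localization.AtPrime.map_eq_maximalIdeal]
    obtain ⟨f, hf, h⟩ := N.exists_mul_mem_span
    refine le_antisymm (Ideal.map_le_iff_le_comap.mpr fun x hx ↦ ?_) ?_
    · obtain ⟨c, hc⟩ := Ideal.mem_span_singleton'.mp (h x hx)
      have hu := IsLocalization.map_units (Localization.AtPrime N.maxIdeal)
        (⟨f, hf⟩ : N.maxIdeal.primeCompl)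
      rw [Ideal.mem_comap, ← Ideal.unit_mul_mem_iff_mem _ hu, ← map_mul, ← hc, map_mul,
        ← IsScalarTower.algebraMap_apply]
      exact Ideal.mul_mem_left _ _ (Ideal.mem_span_singleton_self _)
    · rw [Ideal.span_singleton_le_iff_mem,
        IsScalarTower.algebraMap_apply k[X] N.ring (Localization.AtPrime N.maxIdeal)]
      exact Ideal.mem_map_of_mem _ N.aug_X
  · have : Module.Flat k[X] (Localization.AtPrime N.maxIdeal) := .trans _ N.ring _
    exact algebraMap_X_mem_nonZeroDivisors _

/-- The basic open neighbourhood of the base point defined by a function. -/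
def away (f : N.ring) (hf : N.aug f ≠ 0) : EtaleNbhd k :=
  have : Algebra.Etale N.ring (Localization.Away f) := .of_isLocalizationAway f
  have hu (y : Submonoid.powers f) : IsUnit (N.aug y) := by
    obtain ⟨_, n, rfl⟩ := y
    simp [hf]
  { ring := Localization.Away f
    etale := Algebra.Etale.comp k[X] N.ring _
    aug := IsLocalization.liftAlgHom (M := Submonoid.powers f) (f := N.aug) hu
    aug_X := by
      rw [IsScalarTower.algebraMap_apply k[X] N.ring (Localization.Away f)]
      exact (IsLocalization.lift_eq (M := Submonoid.powers f) (g := N.aug.toRingHom) hu _).trans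
        N.aug_X }

/-- The inclusion of a basic open neighbourhood. -/
def awayHom (f : N.ring) (hf : N.aug f ≠ 0) : N.Hom (N.away f hf) where
  toAlgHom := IsScalarTower.toAlgHom k[X] N.ring (Localization.Away f)
  aug_comp x := IsLocalization.lift_eq (M := Submonoid.powers f) (S := Localization.Away f)
    (g := N.aug.toRingHom) _ x

lemma isDomain_away (f : N.ring) (hf : N.aug f ≠ 0) (h : IsDomain (Localization.Away f)) :
    IsDomain (N.away f hf).ring := h

lemma isUnit_awayHom (f : N.ring) (hf : N.aug f ≠ 0) : IsUnit ((N.awayHom f hf).toAlgHom f) :=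
  IsLocalization.Away.algebraMap_isUnit (S := Localization.Away f) f

lemma exists_isUnit_mul_eq_awayHom (f : N.ring) (hf : N.aug f ≠ 0) (y : (N.away f hf).ring) :
    ∃ u x, IsUnit u ∧ u * y = (N.awayHom f hf).toAlgHom x := by
  obtain ⟨⟨x, s⟩, h⟩ := IsLocalization.surj (S := Localization.Away f) (Submonoid.powers f) y
  exact ⟨_, x, IsLocalization.map_units (Localization.Away f) s, (mul_comm _ _).trans h⟩

/-- The hypothesis `h` holds for localizations: up to units every element of the maximal ideal
upstairs comes from the one below, so `p` contains it. -/
lemma eq_maxIdeal_of_forall_mem {N N' : EtaleNbhd k} (a : N.Hom N')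
    (h : ∀ y : N'.ring, ∃ u x, IsUnit u ∧ u * y = a.toAlgHom x) (p : Ideal N'.ring)
    (hp : p ≠ ⊤) (hpN : ∀ x, N.aug x = 0 → a.toAlgHom x ∈ p) : p = N'.maxIdeal := by
  have hmax : N'.maxIdeal.IsMaximal := inferInstance
  refine (hmax.eq_of_le hp fun y hy ↦ ?_).symm
  obtain ⟨u, x, hu, hx⟩ := h y
  rw [← Ideal.unit_mul_mem_iff_mem _ hu, hx]
  refine hpN x ?_
  rw [← a.aug_comp, ← hx, map_mul, (show N'.aug y = 0 from hy), mul_zero]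

/-- An étale neighbourhood can be shrunk to an integral one on which a given function is
invertible and a given polynomial has no zeros outside the base point. -/
theorem exists_shrink (f₀ : N.ring) (hf₀ : N.aug f₀ ≠ 0) (q : k[X]) (hq : q ≠ 0) :
    ∃ (N' : EtaleNbhd k) (a : N.Hom N'), IsDomain N'.ring ∧ IsUnit (a.toAlgHom f₀) ∧
      ∀ p : Ideal N'.ring, p.IsPrime → algebraMap k[X] N'.ring q ∈ p → p = N'.maxIdeal := by
  obtain ⟨f₁, hf₁, h₁⟩ := exists_notMem_forall_isDomain N.maxIdeal
  obtain ⟨f₂, hf₂, h₂⟩ := N.exists_mul_mem_span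
  obtain ⟨q₁, hq₁, hX⟩ := Polynomial.exists_eq_pow_rootMultiplicity_mul_and_not_dvd q hq 0
  rw [C_0, sub_zero] at hq₁ hX
  -- Inverting `f₁` gives a domain, inverting `f₂` leaves the base point as the only zero of `X`,
  -- and inverting `q₁`, the part of `q` prime to `X`, removes the other zeros of `q`.
  obtain ⟨f, hff₀, hff₁, hff₂, hff₃, hf⟩ : ∃ f, f₀ ∣ f ∧ f₁ ∣ f ∧ f₂ ∣ f ∧
      algebraMap k[X] N.ring q₁ ∣ f ∧ N.aug f ≠ 0 := by
    refine ⟨f₀ * f₁ * f₂ * algebraMap k[X] N.ring q₁, ⟨f₁ * f₂ * algebraMap k[X] N.ring q₁, by ring⟩,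
      ⟨f₀ * f₂ * algebraMap k[X] N.ring q₁, by ring⟩,
      ⟨f₀ * f₁ * algebraMap k[X] N.ring q₁, by ring⟩, ⟨f₀ * f₁ * f₂, by ring⟩, ?_⟩
    simp only [map_mul, aug_algebraMap]
    exact mul_ne_zero (mul_ne_zero (mul_ne_zero hf₀ hf₁) hf₂)
      fun h ↦ hX (Polynomial.X_dvd_iff.mpr ((coeff_zero_eq_eval_zero q₁).trans h))
  have hu (g : N.ring) (hg : g ∣ f) : IsUnit ((N.awayHom f hf).toAlgHom g) :=
    isUnit_of_dvd_unit (map_dvd (N.awayHom f hf).toAlgHom hg) (N.isUnit_awayHom f hf)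
  refine ⟨N.away f hf, N.awayHom f hf, N.isDomain_away f hf (h₁ f hf hff₁), hu f₀ hff₀,
    fun p hp hqp ↦ ?_⟩
  have hXp : algebraMap k[X] (N.away f hf).ring X ∈ p := by
    rw [hq₁, map_mul, map_pow] at hqp
    refine hp.mem_of_pow_mem _ ((Ideal.mul_unit_mem_iff_mem p ?_).mp hqp)
    rw [← (N.awayHom f hf).toAlgHom.commutes]
    exact hu _ hff₃
  refine eq_maxIdeal_of_forall_mem (N.awayHom f hf) (N.exists_isUnit_mul_eq_awayHom f hf) p
    hp.ne_top fun x hx ↦ ?_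
  · rw [← Ideal.unit_mul_mem_iff_mem _ (hu f₂ hff₂), ← map_mul]
    obtain ⟨c, hc⟩ := Ideal.mem_span_singleton'.mp (h₂ x hx)
    rw [← hc, map_mul, AlgHom.commutes]
    exact Ideal.mul_mem_left _ _ hXp

/-- By incomparability over `k[X]`, a nonzero prime contracts to a nonzero, hence maximal, ideal and
is itself maximal. In dimension zero the ring would be a field, yet the augmentation kills `X ≠ 0`.
-/
lemma ringKrullDim_eq_one [IsDomain N.ring] : ringKrullDim N.ring = 1 := by
  apply eq_of_le_of_not_lt ?_ fun h' ↦ ?_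
  · rw [← Nat.cast_one, ← Ring.krullDimLE_iff, Ring.krullDimLE_one_iff_of_noZeroDivisors]
    intro p hp _
    have hpu : p.under k[X] ≠ ⊥ := fun h ↦ hp <| by
      refine (Algebra.QuasiFinite.eq_of_le_of_under_eq (R := k[X]) ⊥ p bot_le ?_).symm
      rw [h, eq_bot_iff, ← h]
      exact Ideal.comap_mono bot_le
    have hpm : (p.under k[X]).IsMaximal :=
      Ideal.IsPrime.isMaximal (R := k[X]) inferInstance hpu
    obtain ⟨m, hm, hpm'⟩ := p.exists_le_maximal (Ideal.IsPrime.ne_top ‹_›)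
    have := Algebra.QuasiFinite.eq_of_le_of_under_eq (R := k[X]) p m hpm'
      (hpm.eq_of_le (Ideal.IsPrime.ne_top inferInstance) (Ideal.comap_mono hpm'))
    rwa [this]
  · have h'' : ringKrullDim N.ring ≤ 0 := Order.le_of_lt_succ h'
    rw [← Nat.cast_zero, ← Ring.krullDimLE_iff] at h''
    have hX := nonZeroDivisors.ne_zero (algebraMap_X_mem_nonZeroDivisors (k := k) N.ring)
    let := (Ring.KrullDimLE.isField_of_isDomain (R := N.ring)).toField
    exact hX ((map_eq_zero_iff N.aug.toRingHom N.aug.toRingHom.injective).mp N.aug_X)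

end EtaleNbhd

/-! ### Quasiprojectivity of affine schemes of finite type; separatedness -/

section Quasiprojective

/-- Dehomogenization: a ring map sending `x` to `1` extends to fractions with denominator a power of
`x`. It yields maps into the chart `x ≠ 0` of `Proj`. -/
lemma exists_away_ringHom {R A σ : Type*} [CommRing R] [CommRing A] [SetLike σ R]
    [AddSubgroupClass σ R] (𝒜 : ℕ → σ) [GradedRing 𝒜] {x : R} (hx : x ∈ 𝒜 1) (ψ : R →+* A)
    (hψ : ψ x = 1) :
    ∃ χ : HomogeneousLocalization.Away 𝒜 x →+* A,
      (∀ r, χ (HomogeneousLocalization.fromZeroRingHom 𝒜 _ r) = ψ r) ∧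
      ∀ y (hy : y ∈ 𝒜 (1 • 1)), χ (HomogeneousLocalization.Away.mk 𝒜 hx 1 y hy) = ψ y := by
  have hψu : ∀ y : Submonoid.powers x, IsUnit (ψ y) := by
    rintro ⟨_, m, rfl⟩
    simp [hψ]
  refine ⟨(IsLocalization.lift (S := Localization (Submonoid.powers x)) hψu).comp
      (algebraMap (HomogeneousLocalization.Away 𝒜 x) (Localization (Submonoid.powers x))),
    fun r ↦ ?_, fun y hy ↦ ?_⟩
  · exact IsLocalization.lift_eq (S := Localization (Submonoid.powers x)) hψu _
  · rw [RingHom.comp_apply, HomogeneousLocalization.algebraMap_apply,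
      HomogeneousLocalization.Away.val_mk, Localization.mk_eq_mk', IsLocalization.lift_mk'_spec]
    simp [hψ]

attribute [local instance] MvPolynomial.gradedAlgebra

/-- An affine scheme of finite type over a field is quasiprojective. -/
theorem isQuasiprojective_Spec {k : Type u} [Field k] (A : Type u) [CommRing A] [Algebra k A]
    [Algebra.FiniteType k A] :
    IsQuasiprojective (Spec.map (CommRingCat.ofHom (algebraMap k A))) := by
  obtain ⟨n, φ, hφ⟩ := Algebra.FiniteType.iff_quotient_mvPolynomial''.mp
    (inferInstance : Algebra.FiniteType k A)
  let 𝒜 := MvPolynomial.homogeneousSubmodule (Fin (n + 1)) k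
  let x₀ : MvPolynomial (Fin (n + 1)) k := MvPolynomial.X 0
  have hx₀ : x₀ ∈ 𝒜 1 := MvPolynomial.isHomogeneous_X k 0
  -- The point with homogeneous coordinates `[1 : a₁ : … : aₙ]`, for generators `aⱼ` of `A`.
  let ψ : MvPolynomial (Fin (n + 1)) k →ₐ[k] A :=
    MvPolynomial.aeval (Fin.cons 1 fun j ↦ φ (MvPolynomial.X j))
  have hψ₀ : ψ x₀ = 1 := by simp [ψ, x₀]
  obtain ⟨χ, hχ₀, hχ₁⟩ := exists_away_ringHom 𝒜 hx₀ ψ.toRingHom hψ₀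
  have hχk (r : k) : χ (HomogeneousLocalization.fromZeroRingHom 𝒜 _ (algebraMap k (𝒜 0) r)) =
      algebraMap k A r := by
    rw [hχ₀]
    exact ψ.commutes r
  have hχ : Function.Surjective χ := by
    intro a
    obtain ⟨p, rfl⟩ := hφ a
    rw [← RingHom.mem_range]
    induction p using MvPolynomial.induction_on with
    | C r => exact ⟨_, (hχk r).trans (φ.commutes r).symm⟩
    | add p q hp hq => rw [map_add]; exact add_mem hp hq
    | mul_X p j hp =>
      rw [map_mul]
      refine mul_mem hp ⟨_, (hχ₁ (MvPolynomial.X j.succ) (MvPolynomial.isHomogeneous_X k _)).trans ?_⟩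
      simp [ψ]
  have := IsClosedImmersion.spec_of_surjective (CommRingCat.ofHom χ) hχ
  have himm : IsImmersion (Spec.map (CommRingCat.ofHom χ) ≫ Proj.awayι 𝒜 x₀ hx₀ one_pos) :=
    inferInstance
  have hcomp : (Spec.map (CommRingCat.ofHom χ) ≫ Proj.awayι 𝒜 x₀ hx₀ one_pos) ≫
      Proj.toSpecZero 𝒜 ≫ Spec.map (CommRingCat.ofHom (algebraMap k (𝒜 0))) =
        Spec.map (CommRingCat.ofHom (algebraMap k A)) := by
    rw [Category.assoc, Proj.awayι_toSpecZero_assoc, ← Spec.map_comp, ← Spec.map_comp]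
    congr 1
    ext r
    exact hχk r
  exact ⟨n, _, himm, hcomp⟩

instance (k : Type u) [Field k] (n : ℕ) : IsSeparated (ProjSpace.toSpec k n) := by
  have h1 := Proj.isSeparated (MvPolynomial.homogeneousSubmodule (Fin (n + 1)) k)
  have h2 : IsSeparated (Spec.map (CommRingCat.ofHom
      (algebraMap k (MvPolynomial.homogeneousSubmodule (Fin (n + 1)) k 0)))) := inferInstance
  exact MorphismProperty.comp_mem @IsSeparated _ _ h1 h2

/-- Separatedness is needed to make the graph of a family of maps finite over `X × N`. -/
lemma IsQuasiprojective.isSeparated {k : Type u} [Field k] {X : Scheme.{u}} {f : X ⟶ Spec (.of k)}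
    (h : IsQuasiprojective f) : IsSeparated f := by
  obtain ⟨n, i, _, rfl⟩ := h
  infer_instance

end Quasiprojective

/-! ### Étale neighbourhoods as pointed curves -/

namespace EtaleNbhd

variable {k : Type u} [Field k] (N : EtaleNbhd k)

/-- The underlying scheme. -/
abbrev scheme : Scheme.{u} := Spec (.of N.ring)

/-- The structure morphism. -/
abbrev toSpec : N.scheme ⟶ Spec (.of k) := Spec.map (CommRingCat.ofHom (algebraMap k N.ring))

/-- The base point, as a section of the structure morphism. -/
abbrev zero : Spec (.of k) ⟶ N.scheme := Spec.map (CommRingCat.ofHom N.aug.toRingHom)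

@[simp]
lemma zero_toSpec : N.zero ≫ N.toSpec = 𝟙 _ := by
  rw [← Spec.map_comp, ← Spec.map_id, ← CommRingCat.ofHom_comp]
  congr 1
  ext r
  exact N.aug.commutes r

/-- The base point. -/
def zeroPt : N.scheme := ⟨N.maxIdeal, inferInstance⟩

lemma zero_apply (x) : N.zero x = N.zeroPt := by
  refine PrimeSpectrum.ext ?_
  have : x.asIdeal = ⊥ := (Ideal.eq_bot_or_top x.asIdeal).resolve_right x.isPrime.ne_top
  change x.asIdeal.comap N.aug.toRingHom = _
  rw [this]
  rfl

lemma isKPoint : IsKPoint N.toSpec N.zeroPt := by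
  refine ⟨N.zero, N.zero_toSpec, ?_⟩
  ext x
  constructor
  · rintro ⟨y, rfl⟩
    exact N.zero_apply y
  · rintro rfl
    exact ⟨⟨⊥, Ideal.isPrime_bot⟩, N.zero_apply _⟩

lemma isCurve [IsDomain N.ring] : IsCurve N.toSpec where
  smooth := by
    have : Algebra.Smooth k k[X] := ⟨inferInstance, inferInstance⟩
    have : Algebra.Smooth k N.ring := Algebra.Smooth.comp k k[X] N.ring
    rw [HasRingHomProperty.Spec_iff (P := @Smooth)]
    exact RingHom.smooth_algebraMap.mpr this
  quasiprojective := isQuasiprojective_Spec _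
  integral := inferInstance
  dim_eq_one := (PrimeSpectrum.topologicalKrullDim_eq_ringKrullDim _).trans N.ringKrullDim_eq_one

variable {N} in
/-- The morphism of schemes attached to a morphism of étale neighbourhoods. -/
abbrev Hom.map {N' : EtaleNbhd k} (a : N.Hom N') : N'.scheme ⟶ N.scheme :=
  Spec.map (CommRingCat.ofHom a.toAlgHom.toRingHom)

variable {N} in
@[simp]
lemma Hom.map_toSpec {N' : EtaleNbhd k} (a : N.Hom N') : a.map ≫ N.toSpec = N'.toSpec := by
  rw [← Spec.map_comp, ← CommRingCat.ofHom_comp]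
  congr 2
  ext r
  exact a.toAlgHom_algebraMap r

variable {N} in
@[simp]
lemma Hom.zero_map {N' : EtaleNbhd k} (a : N.Hom N') : N'.zero ≫ a.map = N.zero := by
  rw [← Spec.map_comp, ← CommRingCat.ofHom_comp]
  congr 2
  ext r
  exact a.aug_comp r

end EtaleNbhd

/-! ### Families of maps over an étale neighbourhood -/

section Move

/-- Locally, a smooth scheme over `k` is étale over an affine space. -/
theorem exists_etale_chart {k : Type u} [Field k] {X : Scheme.{u}} (f : X ⟶ Spec (.of k))
    [Smooth f] (x : X) :
    ∃ (A : CommRingCat.{u}) (j : Spec A ⟶ X) (n : ℕ) (g : MvPolynomial (Fin n) k →+* A),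
      IsOpenImmersion j ∧ x ∈ Set.range j ∧ g.Etale ∧
        j ≫ f = Spec.map (CommRingCat.ofHom (g.comp MvPolynomial.C)) := by
  obtain ⟨W, hW, V, hV, hx, e, he⟩ := Smooth.exists_isStandardSmooth f x
  have hWtop : W = ⊤ := by
    refine top_le_iff.mp fun y _ ↦ ?_
    have hy : y = f x := Subsingleton.elim (α := PrimeSpectrum k) _ _
    exact hy ▸ e hx
  subst hWtop
  let α : CommRingCat.of k ⟶ Γ(X, V) := (Scheme.ΓSpecIso (.of k)).inv ≫ f.appLE ⊤ V e
  have hα : α.hom.IsStandardSmooth :=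
    RingHom.isStandardSmooth_respectsIso.2 _ (Scheme.ΓSpecIso (.of k)).symm.commRingCatIsoToRingEquiv
      he
  obtain ⟨n, g, hg, hge⟩ := hα.exists_etale_mvPolynomial
  refine ⟨Γ(X, V), hV.fromSpec, n, g, inferInstance, ?_, hge, ?_⟩
  · rw [hV.range_fromSpec]
    exact hx
  · rw [hg, CommRingCat.ofHom_hom, Spec.map_comp, ← IsAffineOpen.SpecMap_appLE_fromSpec f hW hV e,
      IsAffineOpen.fromSpec_top, Scheme.isoSpec_Spec_inv]

variable {k : Type u} [Field k]

namespace EtaleNbhd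

variable {R : Scheme.{u}} (h : R ⟶ Spec (.of k)) {N N' : EtaleNbhd k} (a : N.Hom N')

/-- The map of products with `R` attached to a morphism of étale neighbourhoods. -/
def Hom.pullbackMap : pullback h N'.toSpec ⟶ pullback h N.toSpec :=
  pullback.lift (pullback.fst _ _) (pullback.snd _ _ ≫ a.map) (by
    rw [Category.assoc, a.map_toSpec, pullback.condition])

@[simp]
lemma Hom.pullbackMap_fst : a.pullbackMap h ≫ pullback.fst _ _ = pullback.fst _ _ :=
  pullback.lift_fst ..

@[simp]
lemma Hom.pullbackMap_snd : a.pullbackMap h ≫ pullback.snd _ _ = pullback.snd _ _ ≫ a.map :=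
  pullback.lift_snd ..

end EtaleNbhd

/-- An extension of `i : R ⟶ X` to a family of maps parametrised by an étale neighbourhood `N` of
the origin of the affine line, which maps to `U` outside the zeros of some non-zero polynomial. -/
structure Move {X R : Scheme.{u}} (f : X ⟶ Spec (.of k)) (U : X.Opens) (h : R ⟶ Spec (.of k))
    (i : R ⟶ X) (N : EtaleNbhd k) where
  /-- The family of maps. -/
  map : pullback h N.toSpec ⟶ X
  map_comp : map ≫ f = pullback.fst h N.toSpec ≫ h
  -- Describing the section over the base point by its two projections makes restriction and gluing
  -- formal.
  map_zero (σ : R ⟶ pullback h N.toSpec) (h₁ : σ ≫ pullback.fst h N.toSpec = 𝟙 _)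
    (h₂ : σ ≫ pullback.snd h N.toSpec = h ≫ N.zero) : σ ≫ map = i
  /-- The polynomial outside whose zeros the family maps to `U`. -/
  poly : k[X]
  poly_ne_zero : poly ≠ 0
  map_mem (x : ↥(pullback h N.toSpec))
    (hx : algebraMap k[X] N.ring poly ∉ (pullback.snd h N.toSpec x).asIdeal) : map x ∈ U

namespace Move

variable {X R : Scheme.{u}} {f : X ⟶ Spec (.of k)} {U : X.Opens} {h : R ⟶ Spec (.of k)} {i : R ⟶ X}

/-- The restriction of a family of maps to a smaller neighbourhood. -/
def restrict {N N' : EtaleNbhd k} (m : Move f U h i N) (a : N.Hom N') : Move f U h i N' where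
  map := a.pullbackMap h ≫ m.map
  map_comp := by rw [Category.assoc, m.map_comp, ← Category.assoc, a.pullbackMap_fst]
  map_zero σ h₁ h₂ := by
    rw [← Category.assoc]
    refine m.map_zero _ ?_ ?_
    · rw [Category.assoc, a.pullbackMap_fst, h₁]
    · rw [Category.assoc, a.pullbackMap_snd, ← Category.assoc, h₂, Category.assoc, a.zero_map]
  poly := m.poly
  poly_ne_zero := m.poly_ne_zero
  map_mem x hx := by
    rw [Scheme.Hom.comp_apply]
    refine m.map_mem _ fun hmem ↦ hx ?_
    rw [← Scheme.Hom.comp_apply, a.pullbackMap_snd, Scheme.Hom.comp_apply] at hmem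
    have : a.toAlgHom (algebraMap k[X] N.ring m.poly) ∈ (pullback.snd h N'.toSpec x).asIdeal := hmem
    rwa [AlgHom.commutes] at this

end Move

/-- The local case: moving a finite local scheme. -/
theorem exists_move_of_isLocalRing [IsAlgClosed k] {X : Scheme.{u}} (f : X ⟶ Spec (.of k))
    [Smooth f] (U : X.Opens) (hU : Dense (U : Set X)) (B : Type u) [CommRing B] [IsLocalRing B]
    [Algebra k B] [Module.Finite k B] (h : Spec (.of B) ⟶ Spec (.of k))
    (hh : h = Spec.map (CommRingCat.ofHom (algebraMap k B))) (i : Spec (.of B) ⟶ X)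
    (hi : i ≫ f = h) :
    ∃ N, Nonempty (Move f U h i N) := by
  subst hh
  obtain ⟨A, j, n, g, _, hx, hg, hj⟩ := exists_etale_chart f (i (IsLocalRing.closedPoint B))
  -- Every point of a local scheme specializes to the closed point, so an open chart containing the
  -- image of the latter contains the whole image.
  have hrange : Set.range i ⊆ Set.range j := by
    rintro _ ⟨y, rfl⟩
    have : (i y) ⤳ i (IsLocalRing.closedPoint B) :=
      (IsLocalRing.specializes_closedPoint y).map i.continuous
    exact this.mem_open j.isOpenEmbedding.isOpen_range hx
  let φ : A ⟶ .of B := Spec.preimage (IsOpenImmersion.lift j i hrange)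
  have hφ : Spec.map φ ≫ j = i := by
    rw [Spec.map_preimage, IsOpenImmersion.lift_fac]
  let := g.toAlgebra
  have : Algebra.Etale (MvPolynomial (Fin n) k) A := hg
  have hφk (r : k) : φ.hom (algebraMap (MvPolynomial (Fin n) k) A (MvPolynomial.C r)) =
      algebraMap k B r := by
    rw [← hφ, Category.assoc, hj, ← Spec.map_comp] at hi
    exact congr($(Spec.map_injective hi) r)
  obtain ⟨N, Φ, q, hq, hΦk, hΦ, hΦU⟩ := exists_local_move φ.hom hφk
    (U := j ⁻¹' U) (U.isOpen.preimage j.continuous) (hU.preimage j.isOpenEmbedding.isOpenMap)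
  let hk := Spec.map (CommRingCat.ofHom (algebraMap k B))
  refine ⟨N, ⟨(pullbackSpecIso k B N.ring).hom ≫ Spec.map (CommRingCat.ofHom Φ) ≫ j, ?_, ?_, q, hq,
    ?_⟩⟩
  · rw [Category.assoc, Category.assoc, hj, ← pullbackSpecIso_hom_base, ← Spec.map_comp]
    congr 2
    ext r
    exact hΦk r
  · intro σ h₁ h₂
    let ε : B ⊗[k] N.ring →ₐ[k] B := Algebra.TensorProduct.lift (AlgHom.id k B)
      ((Algebra.ofId k B).comp N.aug) fun _ _ ↦ .all _ _
    have hσ : σ = Spec.map (CommRingCat.ofHom ε.toRingHom) ≫ (pullbackSpecIso k B N.ring).inv := by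
      apply pullback.hom_ext
      · rw [h₁, Category.assoc, pullbackSpecIso_inv_fst, ← Spec.map_comp, ← Spec.map_id]
        congr 1
        ext b
        simp [ε]
      · rw [h₂, Category.assoc, pullbackSpecIso_inv_snd, ← Spec.map_comp, ← Spec.map_comp]
        congr 1
        ext b
        simp [ε, Algebra.ofId_apply]
    rw [hσ, Category.assoc, Iso.inv_hom_id_assoc, ← Spec.map_comp_assoc, ← hφ]
    congr 2
    ext a
    exact RingHom.congr_fun hΦ a
  · intro x hx
    rw [Scheme.Hom.comp_apply, Scheme.Hom.comp_apply]
    refine hΦU _ fun hmem ↦ hx ?_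
    rw [← pullbackSpecIso_hom_snd, Scheme.Hom.comp_apply]
    exact hmem

end Move

/-! ### Gluing the local moves -/

section Gluing

variable {k : Type u} [Field k]

/-- The cover of a locally Artinian scheme by the spectra of its local rings. -/
lemma exists_singleton_chart (R : Scheme.{u}) [IsLocallyArtinian R] (p : R) :
    ∃ (B : CommRingCat.{u}) (j : Spec B ⟶ R), IsOpenImmersion j ∧ IsLocalRing B ∧
      Set.range j = {p} := by
  obtain ⟨_, ⟨V, hV, rfl⟩, hxV, hVU⟩ := R.isBasis_affineOpens.exists_subset_of_mem_open
    (Set.mem_singleton p) (isOpen_discrete _)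
  have hr : Set.range hV.fromSpec = {p} := by
    rw [hV.range_fromSpec]
    exact Set.Subset.antisymm hVU (Set.singleton_subset_iff.mpr hxV)
  have hj : IsOpenImmersion (IsAffineOpen.fromSpec (X := R) (U := V) hV) :=
    IsAffineOpen.isOpenImmersion_fromSpec _
  refine ⟨Γ(R, V), IsAffineOpen.fromSpec (X := R) (U := V) hV, hj, ?_, hr⟩
  have hss : Subsingleton ↥(Spec Γ(R, V)) := ⟨fun x y ↦
    (IsAffineOpen.fromSpec (X := R) (U := V) hV).isOpenEmbedding.injective <| by
      have hx : hV.fromSpec x ∈ Set.range hV.fromSpec := ⟨x, rfl⟩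
      have hy : hV.fromSpec y ∈ Set.range hV.fromSpec := ⟨y, rfl⟩
      rw [hr] at hx hy
      exact hx.trans hy.symm⟩
  obtain ⟨x, -⟩ : p ∈ Set.range hV.fromSpec := hr ▸ rfl
  have := PrimeSpectrum.nonempty_iff_nontrivial.mp ⟨x⟩
  refine IsLocalRing.of_unique_max_ideal ⟨x.asIdeal, ?_, fun m hm ↦ ?_⟩
  · obtain ⟨m, hm⟩ := Ideal.exists_maximal Γ(R, V)
    rwa [Subsingleton.elim x ⟨m, hm.isPrime⟩]
  · exact congrArg PrimeSpectrum.asIdeal (Subsingleton.elim ⟨m, hm.isPrime⟩ x)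

/-- The open cover given by a jointly surjective family of open immersions. -/
def openCoverOfSurjective {M : Scheme.{u}} {I : Type u} {Y : I → Scheme.{u}} (κ : ∀ a, Y a ⟶ M)
    (hκ : ∀ a, IsOpenImmersion (κ a)) (hs : ∀ x, ∃ a y, κ a y = x) : M.OpenCover where
  I₀ := I
  X := Y
  f := κ
  mem₀ := by
    rw [Scheme.presieve₀_mem_precoverage_iff]
    exact ⟨fun x ↦ let ⟨a, y, h⟩ := hs x; ⟨a, y, h⟩, hκ⟩

lemma hom_ext_of_surjective {M Z : Scheme.{u}} {I : Type u} {Y : I → Scheme.{u}}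
    (κ : ∀ a, Y a ⟶ M) (hκ : ∀ a, IsOpenImmersion (κ a)) (hs : ∀ x, ∃ a y, κ a y = x)
    (u v : M ⟶ Z) (h : ∀ a, κ a ≫ u = κ a ≫ v) : u = v :=
  Scheme.Cover.hom_ext (openCoverOfSurjective κ hκ hs) _ _ h

/-- Gluing morphisms along a cover by disjoint open subschemes. -/
lemma exists_glue_of_disjoint {M Z : Scheme.{u}} {I : Type u} {Y : I → Scheme.{u}}
    (κ : ∀ a, Y a ⟶ M) (hκ : ∀ a, IsOpenImmersion (κ a)) (hs : ∀ x, ∃ a y, κ a y = x)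
    (hd : ∀ a b x y, κ a x = κ b y → a = b) (F : ∀ a, Y a ⟶ Z) :
    ∃ Ψ : M ⟶ Z, ∀ a, κ a ≫ Ψ = F a := by
  have hF : ∀ a b, pullback.fst (κ a) (κ b) ≫ F a = pullback.snd _ _ ≫ F b := by
    intro a b
    by_cases hab : a = b
    · subst hab
      rw [(cancel_mono (κ a)).mp (pullback.condition (f := κ a) (g := κ a))]
    · have : IsEmpty ↥(pullback (κ a) (κ b)) := ⟨fun w ↦ by
        refine hab (hd a b (pullback.fst (κ a) (κ b) w) (pullback.snd (κ a) (κ b) w) ?_)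
        rw [← Scheme.Hom.comp_apply, ← Scheme.Hom.comp_apply, pullback.condition]⟩
      exact isInitialOfIsEmpty.hom_ext _ _
  exact ⟨(openCoverOfSurjective κ hκ hs).glueMorphisms F hF,
    fun a ↦ (openCoverOfSurjective κ hκ hs).ι_glueMorphisms F hF a⟩

/-- The cover of a product induced by a cover of the first factor. -/
lemma exists_pullback_cover {R S T : Scheme.{u}} (h : R ⟶ S) (g : T ⟶ S) {I : Type u}
    {Y : I → Scheme.{u}} (κ : ∀ a, Y a ⟶ R) (hκ : ∀ a, IsOpenImmersion (κ a))
    (hs : ∀ x, ∃ a y, κ a y = x) :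
    ∃ μ : ∀ a, pullback (κ a ≫ h) g ⟶ pullback h g, (∀ a, IsOpenImmersion (μ a)) ∧
      (∀ x, ∃ a y, μ a y = x) ∧ (∀ a, μ a ≫ pullback.fst _ _ = pullback.fst _ _ ≫ κ a) ∧
      ∀ a, μ a ≫ pullback.snd _ _ = pullback.snd _ _ :=
  let 𝒱 := Scheme.Pullback.openCoverOfLeft (openCoverOfSurjective κ hκ hs) h g
  ⟨fun a ↦ 𝒱.f a, fun a ↦ 𝒱.map_prop a, fun x ↦ 𝒱.exists_eq x, fun _ ↦ pullback.lift_fst ..,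
    fun _ ↦ (pullback.lift_snd ..).trans (Category.comp_id _)⟩

/-- A finite scheme in a smooth scheme extends to a family of maps which meets a given dense open
subset generically. -/
theorem exists_move [IsAlgClosed k] {X R : Scheme.{u}} (f : X ⟶ Spec (.of k)) [Smooth f]
    (U : X.Opens) (hU : Dense (U : Set X)) (h : R ⟶ Spec (.of k)) [IsFinite h] (i : R ⟶ X)
    (hi : i ≫ f = h) : ∃ N, Nonempty (Move f U h i N) := by
  classical
  have : IsLocallyArtinian (Spec (.of k)) := Scheme.isLocallyArtinianScheme_Spec.mpr
    (inferInstanceAs (IsArtinianRing k))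
  have : IsLocallyArtinian R := .of_locallyQuasiFinite h
  have : CompactSpace R := QuasiCompact.compactSpace_of_compactSpace h
  have : Finite R := finite_of_compact_of_discrete
  choose B j hj hB hr using exists_singleton_chart R
  have hs (p : R) : ∃ a y, j a y = p := by
    obtain ⟨y, hy⟩ : p ∈ Set.range (j p) := by rw [hr]; rfl
    exact ⟨p, y, hy⟩
  have hloc (p : R) : ∃ N, Nonempty (Move f U (j p ≫ h) (j p ≫ i) N) := by
    let := (Spec.preimage (j p ≫ h)).hom.toAlgebra
    have hh : j p ≫ h = Spec.map (CommRingCat.ofHom (algebraMap k (B p))) :=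
      (Spec.map_preimage _).symm
    have : IsFinite (j p ≫ h) := .of_locallyQuasiFinite _
    have : Module.Finite k (B p) := by
      rw [hh, IsFinite.SpecMap_iff] at this
      exact this
    exact exists_move_of_isLocalRing f U hU (B p) _ hh _ (by rw [Category.assoc, hi])
  choose N' m' using hloc
  -- All pieces must move over the same base; on it the product of their polynomials serves for the
  -- glued family.
  obtain ⟨N, a⟩ := EtaleNbhd.exists_refinement N'
  let m (p : R) : Move f U (j p ≫ h) (j p ≫ i) N := (m' p).some.restrict (a p).some
  obtain ⟨μ, hμ, hμs, hμ₁, hμ₂⟩ := exists_pullback_cover h N.toSpec j hj hs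
  have hμp (p : R) (x) : pullback.fst h N.toSpec (μ p x) = p := by
    have : pullback.fst h N.toSpec (μ p x) ∈ Set.range (j p) := by
      rw [← Scheme.Hom.comp_apply, hμ₁, Scheme.Hom.comp_apply]
      exact ⟨_, rfl⟩
    rwa [hr] at this
  obtain ⟨Ψ, hΨ⟩ := exists_glue_of_disjoint μ hμ hμs (fun p q x y hxy ↦ by
    rw [← hμp p x, hxy, hμp]) fun p ↦ (m p).map
  have := Fintype.ofFinite R
  refine ⟨N, ⟨Ψ, ?_, ?_, ∏ p, (m p).poly, Finset.prod_ne_zero_iff.mpr fun p _ ↦ (m p).poly_ne_zero,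
    fun x hx ↦ ?_⟩⟩
  · refine hom_ext_of_surjective μ hμ hμs _ _ fun p ↦ ?_
    rw [← Category.assoc, hΨ, (m p).map_comp, ← Category.assoc, ← Category.assoc, hμ₁]
  · intro σ h₁ h₂
    refine hom_ext_of_surjective j hj hs _ _ fun p ↦ ?_
    have h0 : 𝟙 (Spec (B p)) ≫ j p ≫ h = ((j p ≫ h) ≫ N.zero) ≫ N.toSpec := by simp
    have hσ : pullback.lift _ _ h0 ≫ μ p = j p ≫ σ := by
      apply pullback.hom_ext
      · rw [Category.assoc, hμ₁, ← Category.assoc, pullback.lift_fst, Category.assoc, h₁,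
          Category.id_comp, Category.comp_id]
      · rw [Category.assoc, hμ₂, pullback.lift_snd, Category.assoc, Category.assoc, h₂]
    rw [← Category.assoc, ← hσ, Category.assoc, hΨ]
    exact (m p).map_zero _ (pullback.lift_fst ..) (pullback.lift_snd ..)
  · obtain ⟨p, y, rfl⟩ := hμs x
    rw [← Scheme.Hom.comp_apply, hΨ]
    refine (m p).map_mem y fun hmem ↦ hx ?_
    rw [← Scheme.Hom.comp_apply, hμ₂]
    obtain ⟨c, hc⟩ := map_dvd (algebraMap k[X] N.ring)
      (Finset.dvd_prod_of_mem (fun p ↦ (m p).poly) (Finset.mem_univ p))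
    rw [hc]
    exact Ideal.mul_mem_right _ _ hmem

end Gluing

/-! ### Monomorphisms near the base point -/

section Monomorphisms

/-- An idempotent endomorphism of a finite module that is the identity modulo an ideal `m` is the
identity near `m`. -/
lemma exists_smul_sub_eq_zero {C E : Type*} [CommRing C] [AddCommGroup E] [Module C E]
    [Module.Finite C E] (m : Ideal C) (τ : E →ₗ[C] E) (hτ : ∀ x, τ (τ x) = τ x)
    (hm : ∀ x, x - τ x ∈ m • (⊤ : Submodule C E)) :
    ∃ r, r - 1 ∈ m ∧ ∀ x, r • (x - τ x) = 0 := by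
  -- Since `ρ` is idempotent with image in `m • E`, its image lies in `m` times itself, and Nakayama
  -- applies.
  let ρ : E →ₗ[C] E := LinearMap.id - τ
  obtain ⟨r, hr, h⟩ := Submodule.exists_sub_one_mem_and_smul_eq_zero_of_fg_of_le_smul m
    (LinearMap.range ρ) (LinearMap.range_eq_map ρ ▸ Module.Finite.fg_top.map ρ)
    (by
      rintro _ ⟨x, rfl⟩
      have h1 : ρ x = ρ (ρ x) := by simp [ρ, hτ]
      have h2 := Submodule.mem_map_of_mem (f := ρ) (hm x)
      rw [Submodule.map_smul'', ← LinearMap.range_eq_map] at h2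
      rw [h1]
      exact h2)
  exact ⟨r, hr, fun x ↦ h _ ⟨x, rfl⟩⟩

variable {k : Type u} [Field k]

/-- An idempotent endomorphism of a finite scheme over an étale neighbourhood that is the identity
over the base point is the identity near the base point. -/
lemma exists_comp_eq_of_idem (N : EtaleNbhd k) {Q : Scheme.{u}} (π : Q ⟶ N.scheme) [IsFinite π]
    (θ : Q ⟶ Q) (hπ : θ ≫ π = π) (hθ : θ ≫ θ = θ)
    (h0 : ∀ (Z : Scheme.{u}) (z : Z ⟶ Q), z ≫ π = z ≫ π ≫ N.toSpec ≫ N.zero → z ≫ θ = z) :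
    ∃ r, N.aug r ≠ 0 ∧ ∀ (N' : EtaleNbhd k) (a : N.Hom N') (W : Scheme.{u}) (w : W ⟶ Q)
      (g : W ⟶ N'.scheme), w ≫ π = g ≫ a.map → IsUnit (a.toAlgHom r) → w ≫ θ = w := by
  have : IsAffine Q := isAffine_of_isAffineHom π
  let c : CommRingCat.of N.ring ⟶ Γ(Q, ⊤) := (Scheme.ΓSpecIso (.of N.ring)).inv ≫ π.appTop
  let := c.hom.toAlgebra
  have hfin : Module.Finite N.ring Γ(Q, ⊤) := by
    have h1 : π.appTop.hom.Finite := π.finite_app ⊤ (isAffineOpen_top _)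
    exact h1.comp (.of_surjective _
      (Scheme.ΓSpecIso (.of N.ring)).commRingCatIsoToRingEquiv.symm.surjective)
  have hτc (r : N.ring) : θ.appTop.hom (c.hom r) = c.hom r := by
    have : c ≫ θ.appTop = c := by
      rw [Category.assoc, ← Scheme.Hom.comp_appTop, hπ]
    exact congr($this r)
  have hττ (x) : θ.appTop.hom (θ.appTop.hom x) = θ.appTop.hom x := by
    have : θ.appTop ≫ θ.appTop = θ.appTop := by
      rw [← Scheme.Hom.comp_appTop, hθ]
    exact congr($this x)
  let τ : Γ(Q, ⊤) →ₗ[N.ring] Γ(Q, ⊤) :=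
    { θ.appTop.hom with
      map_smul' := fun r x ↦ by
        change θ.appTop.hom (c.hom r * x) = c.hom r * θ.appTop.hom x
        rw [map_mul, hτc] }
  have hm (x) : x - τ x ∈ N.maxIdeal • (⊤ : Submodule N.ring Γ(Q, ⊤)) := by
    rw [Ideal.smul_top_eq_map]
    -- Apply `h0` to the closed subscheme of `Q` lying over the base point.
    let J : Ideal Γ(Q, ⊤) := N.maxIdeal.map (algebraMap N.ring Γ(Q, ⊤))
    let q : Γ(Q, ⊤) ⟶ CommRingCat.of (Γ(Q, ⊤) ⧸ J) := CommRingCat.ofHom (Ideal.Quotient.mk J)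
    let z : Spec (.of (Γ(Q, ⊤) ⧸ J)) ⟶ Q := Spec.map q ≫ Q.isoSpec.inv
    have hzπ : z ≫ π = Spec.map (c ≫ q) := by
      rw [Category.assoc, ← Scheme.isoSpec_inv_naturality, Scheme.isoSpec_Spec_inv, ← Spec.map_comp,
        ← Spec.map_comp, Category.assoc]
    have hz : z ≫ θ = z := by
      refine h0 _ z ?_
      rw [← Category.assoc z, hzπ, ← Spec.map_comp, ← Spec.map_comp]
      congr 1
      ext y
      refine Ideal.Quotient.eq.mpr ?_
      change algebraMap N.ring _ y - algebraMap N.ring _ (algebraMap k N.ring (N.aug y)) ∈ J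
      rw [← map_sub]
      refine Ideal.mem_map_of_mem _ ?_
      change N.aug _ = 0
      rw [map_sub, sub_eq_zero]
      exact (N.aug.commutes _).symm
    have hzx : θ.appTop ≫ q = q := by
      rw [Category.assoc, ← Scheme.isoSpec_inv_naturality, ← Category.assoc, ← Spec.map_comp,
        cancel_mono] at hz
      exact Spec.map_injective hz
    exact Ideal.Quotient.eq.mp congr($hzx x).symm
  obtain ⟨r, hr, h⟩ := exists_smul_sub_eq_zero N.maxIdeal τ hττ hm
  refine ⟨r, ?_, fun N' a W w g hw hu ↦ ?_⟩
  · have : N.aug r = 1 := by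
      have : N.aug (r - 1) = 0 := hr
      rwa [map_sub, map_one, sub_eq_zero] at this
    simp [this]
  · refine ext_of_isAffine ?_
    ext x
    have h1 : c ≫ w.appTop = CommRingCat.ofHom a.toAlgHom.toRingHom ≫
        (Scheme.ΓSpecIso (.of N'.ring)).inv ≫ g.appTop := by
      rw [Category.assoc, ← Scheme.Hom.comp_appTop, hw, Scheme.Hom.comp_appTop,
        ← Scheme.ΓSpecIso_inv_naturality_assoc]
    have h2 : IsUnit (w.appTop.hom (c.hom r)) := by
      have : w.appTop.hom (c.hom r) = _ := congr($h1 r)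
      rw [this]
      exact hu.map ((Scheme.ΓSpecIso (.of N'.ring)).inv ≫ g.appTop).hom
    have h3 : c.hom r * (x - θ.appTop.hom x) = 0 := h x
    have h4 := congr(w.appTop.hom $h3)
    rw [map_mul, map_zero, h2.mul_right_eq_zero, map_sub, sub_eq_zero] at h4
    rw [Scheme.Hom.comp_appTop]
    exact h4.symm

variable {X R : Scheme.{u}} {f : X ⟶ Spec (.of k)} {U : X.Opens} {h : R ⟶ Spec (.of k)} {i : R ⟶ X}

/-- The graph of a family of maps, as a map to the product with the base. -/
def Move.incl {N : EtaleNbhd k} (m : Move f U h i N) : pullback h N.toSpec ⟶ pullback f N.toSpec :=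
  pullback.lift m.map (pullback.snd _ _) (by rw [m.map_comp, pullback.condition])

@[simp]
lemma Move.incl_fst {N : EtaleNbhd k} (m : Move f U h i N) : m.incl ≫ pullback.fst _ _ = m.map :=
  pullback.lift_fst ..

@[simp]
lemma Move.incl_snd {N : EtaleNbhd k} (m : Move f U h i N) :
    m.incl ≫ pullback.snd _ _ = pullback.snd _ _ :=
  pullback.lift_snd ..

instance Move.isFinite_incl [IsSeparated f] [IsFinite h] {N : EtaleNbhd k} (m : Move f U h i N) :
    IsFinite m.incl := by
  have : IsFinite (m.incl ≫ pullback.snd f N.toSpec) := by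
    rw [m.incl_snd]
    infer_instance
  exact .of_comp m.incl (pullback.snd f N.toSpec)

/-- Near the base point, a family of maps that extends a monomorphism consists of monomorphisms. -/
theorem Move.exists_mono_incl [IsSeparated f] [IsFinite h] [Mono i] {N : EtaleNbhd k}
    (m : Move f U h i N) :
    ∃ r, N.aug r ≠ 0 ∧ ∀ (N' : EtaleNbhd k) (a : N.Hom N'), IsUnit (a.toAlgHom r) →
      Mono (m.restrict a).incl := by
  let p₁ := pullback.fst m.incl m.incl
  let p₂ := pullback.snd m.incl m.incl
  have hp : p₁ ≫ m.incl = p₂ ≫ m.incl := pullback.condition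
  have hp₁ : p₁ ≫ m.map = p₂ ≫ m.map := by
    rw [← m.incl_fst, ← Category.assoc, hp, Category.assoc]
  have hp₂ : p₁ ≫ pullback.snd h N.toSpec = p₂ ≫ pullback.snd h N.toSpec := by
    rw [← m.incl_snd, ← Category.assoc, hp, Category.assoc]
  let δ := pullback.diagonal m.incl
  have hδ₁ : δ ≫ p₁ = 𝟙 _ := pullback.lift_fst ..
  have hδ₂ : δ ≫ p₂ = 𝟙 _ := pullback.lift_snd ..
  let σ : R ⟶ pullback h N.toSpec := pullback.lift (𝟙 R) (h ≫ N.zero) (by simp)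
  have hσ₁ : σ ≫ pullback.fst _ _ = 𝟙 _ := pullback.lift_fst ..
  have hσ₂ : σ ≫ pullback.snd _ _ = h ≫ N.zero := pullback.lift_snd ..
  have hfin : IsFinite (p₁ ≫ pullback.snd h N.toSpec) := inferInstance
  -- The idempotent `p₁ ≫ δ` sends a pair `(x, y)` to `(x, x)`. It fixes exactly the pairs with
  -- equal entries, so its being the identity means that `m.incl` is a monomorphism.
  obtain ⟨r, hr, hmono⟩ := exists_comp_eq_of_idem N (p₁ ≫ pullback.snd h N.toSpec) (p₁ ≫ δ)
    (by rw [Category.assoc, ← Category.assoc δ, hδ₁, Category.id_comp])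
    (by rw [Category.assoc, ← Category.assoc δ, hδ₁, Category.id_comp]) (by
      intro Z z hz
      -- Over the base point both entries factor through `σ`, where the family is the monomorphism
      -- `i`.
      have key (p) (hπ : p ≫ pullback.snd h N.toSpec = p₁ ≫ pullback.snd h N.toSpec) :
          z ≫ p = (z ≫ p ≫ pullback.fst _ _) ≫ σ := by
        apply pullback.hom_ext
        · simp only [Category.assoc, hσ₁, Category.comp_id]
        · simp only [Category.assoc, hσ₂, pullback.condition_assoc]
          rw [← Category.assoc p, hπ]
          simpa using hz
      have hz₁ := key p₁ rfl
      have hz₂ := key p₂ hp₂.symm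
      have heq : z ≫ p₁ ≫ pullback.fst _ _ = z ≫ p₂ ≫ pullback.fst _ _ := by
        have hσi := m.map_zero σ hσ₁ hσ₂
        have h₁ : z ≫ p₁ ≫ m.map = (z ≫ p₁ ≫ pullback.fst _ _) ≫ i := by
          rw [← Category.assoc, hz₁, Category.assoc, hσi]
        have h₂ : z ≫ p₂ ≫ m.map = (z ≫ p₂ ≫ pullback.fst _ _) ≫ i := by
          rw [← Category.assoc, hz₂, Category.assoc, hσi]
        rw [← cancel_mono i, ← h₁, ← h₂, hp₁]
      have heq' : z ≫ p₁ = z ≫ p₂ := by rw [hz₁, heq, ← hz₂]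
      apply pullback.hom_ext
      · change (z ≫ p₁ ≫ δ) ≫ p₁ = z ≫ p₁
        simp only [Category.assoc, hδ₁, Category.comp_id]
      · change (z ≫ p₁ ≫ δ) ≫ p₂ = z ≫ p₂
        simp only [Category.assoc, hδ₂, Category.comp_id, heq'])
  refine ⟨r, hr, fun N' a hu ↦ ⟨fun {W} g₁ g₂ hg ↦ ?_⟩⟩
  have hg₁ : g₁ ≫ a.pullbackMap h ≫ m.map = g₂ ≫ a.pullbackMap h ≫ m.map := by
    have := congr($hg ≫ pullback.fst _ _)
    rwa [Category.assoc, Category.assoc, (m.restrict a).incl_fst] at this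
  have hg₂ : g₁ ≫ pullback.snd h N'.toSpec = g₂ ≫ pullback.snd h N'.toSpec := by
    have := congr($hg ≫ pullback.snd _ _)
    rwa [Category.assoc, Category.assoc, (m.restrict a).incl_snd] at this
  let w : W ⟶ pullback m.incl m.incl :=
    pullback.lift (g₁ ≫ a.pullbackMap h) (g₂ ≫ a.pullbackMap h) (by
      apply pullback.hom_ext
      · simpa using hg₁
      · simp only [Category.assoc, m.incl_snd, a.pullbackMap_snd]
        rw [← Category.assoc, hg₂, Category.assoc])
  have hw₁ : w ≫ p₁ = g₁ ≫ a.pullbackMap h := pullback.lift_fst ..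
  have hw₂ : w ≫ p₂ = g₂ ≫ a.pullbackMap h := pullback.lift_snd ..
  have hw := hmono N' a W w (g₁ ≫ pullback.snd _ _) (by
    rw [← Category.assoc, hw₁, Category.assoc, a.pullbackMap_snd, Category.assoc]) hu
  have hβ : g₁ ≫ a.pullbackMap h = g₂ ≫ a.pullbackMap h := by
    rw [← hw₁, ← hw₂, ← hw]
    simp only [Category.assoc, hδ₁, hδ₂]
  apply pullback.hom_ext
  · simpa using congr($hβ ≫ pullback.fst _ _)
  · exact hg₂

end Monomorphisms

/-! ### The flat family and its fibres -/

section Families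

variable {k : Type u} [Field k]

/-- The residue field of the base point is the base field. -/
lemma EtaleNbhd.exists_iso_residueField [IsAlgClosed k] (N : EtaleNbhd k) :
    ∃ ε : Spec (.of k) ≅ Spec (N.scheme.residueField N.zeroPt),
      ε.hom ≫ N.scheme.fromSpecResidueField N.zeroPt = N.zero := by
  have hcl : IsClosed ({N.zeroPt} : Set N.scheme) :=
    (PrimeSpectrum.isClosed_singleton_iff_isMaximal _).mpr (inferInstanceAs N.maxIdeal.IsMaximal)
  have hft : LocallyOfFiniteType N.toSpec := by
    rw [HasRingHomProperty.Spec_iff (P := @LocallyOfFiniteType)]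
    exact RingHom.finiteType_algebraMap.mpr inferInstance
  -- Over an algebraically closed field, a section of a scheme locally of finite type is determined
  -- by its image point.
  have hpt : pointOfClosedPoint N.toSpec N.zeroPt hcl = N.zero :=
    ext_of_apply_closedPoint_eq N.toSpec (by simp) N.zero_toSpec
      ((pointOfClosedPoint_apply N.toSpec N.zeroPt hcl _).trans (N.zero_apply _).symm)
  exact ⟨Scheme.Spec.mapIso (residueFieldIsoBase N.toSpec N.zeroPt hcl).op, hpt⟩

variable {X R : Scheme.{u}} {f : X ⟶ Spec (.of k)} {U : X.Opens} {h : R ⟶ Spec (.of k)} {i : R ⟶ X}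

/-- A morphism from a non-empty scheme to the spectrum of a field is surjective. -/
lemma surjective_of_nonempty [Nonempty R] (h : R ⟶ Spec (.of k)) : Surjective h :=
  ⟨fun _ ↦ ⟨Classical.arbitrary R, Subsingleton.elim (α := PrimeSpectrum k) _ _⟩⟩

/-- The flat family of subschemes attached to a family of monomorphisms. -/
def Move.family [IsSeparated f] [IsFinite h] [Surjective h] {N : EtaleNbhd k}
    (m : Move f U h i N) [Mono m.incl] : FlatFamily f N.toSpec where
  total := pullback h N.toSpec
  incl := m.incl
  -- A finite monomorphism is a closed immersion.
  isClosedImmersion := IsClosedImmersion.iff_isFinite_and_mono _ |>.mpr ⟨inferInstance, ‹_›⟩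
  flat := by rw [m.incl_snd]; infer_instance
  surjective := by rw [m.incl_snd]; infer_instance

variable [IsSeparated f] [IsFinite h] [Surjective h] {N : EtaleNbhd k}
    (m : Move f U h i N) [Mono m.incl]

lemma Move.family_proj : m.family.proj = pullback.snd h N.toSpec := m.incl_snd

lemma Move.family_toX : m.family.toX = m.map := m.incl_fst

lemma Move.isFinite_family_proj : IsFinite m.family.proj := by
  have : IsFinite (pullback.snd h N.toSpec) := inferInstance
  rw [m.family_proj]
  exact this

/-- The fibre over the base point is the original subscheme. -/
theorem Move.exists_fibre_zero_iso [IsAlgClosed k] :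
    ∃ e : m.family.fibre N.zeroPt ≅ R, e.hom ≫ i = m.family.fibreToX N.zeroPt := by
  obtain ⟨ε, hε⟩ := N.exists_iso_residueField
  let σ : R ⟶ pullback h N.toSpec := pullback.lift (𝟙 R) (h ≫ N.zero) (by simp)
  have hσ₁ : σ ≫ pullback.fst _ _ = 𝟙 _ := pullback.lift_fst ..
  have hσ₂ : σ ≫ pullback.snd _ _ = h ≫ N.zero := pullback.lift_snd ..
  -- By pasting: the outer square lies over the identity of `Spec k`.
  have h1 : IsPullback σ h (pullback.snd h N.toSpec) N.zero := by
    refine .of_right (v₁₃ := h) (h₂₂ := N.toSpec) ?_ hσ₂ (.of_hasPullback h N.toSpec)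
    rw [hσ₁, N.zero_toSpec]
    exact .of_horiz_isIso ⟨by simp⟩
  have h2 : IsPullback σ (h ≫ ε.hom) m.family.proj (N.scheme.fromSpecResidueField N.zeroPt) := by
    rw [m.family_proj]
    exact h1.of_iso (Iso.refl _) (Iso.refl _) ε (Iso.refl _) (by simp) (by simp) (by simp)
      (by simp [hε])
  refine ⟨h2.isoPullback.symm, ?_⟩
  have h3 : h2.isoPullback.inv ≫ σ = m.family.proj.fiberι N.zeroPt := h2.isoPullback_inv_fst
  have h4 := m.map_zero σ hσ₁ hσ₂
  rw [FlatFamily.fibreToX, m.family_toX, ← h3]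
  exact (congrArg (h2.isoPullback.inv ≫ ·) h4.symm).trans (Category.assoc ..).symm

/-- Over the other points the family lies in `U`. -/
lemma Move.range_fibreToX_subset (t : N.scheme)
    (ht : algebraMap k[X] N.ring m.poly ∉ t.asIdeal) :
    Set.range (m.family.fibreToX t) ⊆ (U : Set X) := by
  rintro _ ⟨y, rfl⟩
  have hy : m.family.fibreToX t y = m.map (m.family.proj.fiberι t y) := by
    rw [FlatFamily.fibreToX, m.family_toX]
    exact Scheme.Hom.comp_apply ..
  rw [hy]
  refine m.map_mem _ ?_
  have : m.family.proj.fiberι t y ∈ m.family.proj ⁻¹' {t} := by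
    rw [← Scheme.Hom.range_fiberι]
    exact ⟨y, rfl⟩
  have hyt : pullback.snd h N.toSpec (m.family.proj.fiberι t y) = t :=
    (congr($m.family_proj.symm (m.family.proj.fiberι t y))).trans this
  rwa [hyt]

end Families

end MovingSchemes

end

/-! ### The moving theorem -/

theorem mainTheorem6 {k : Type u} [Field k] [IsAlgClosed k]
    {X : Scheme.{u}} (f : X ⟶ Spec (.of k)) (hsmooth : Smooth f)
    (hqp : MovingSchemes.IsQuasiprojective f)
    (U : X.Opens) (hU : Dense (U : Set X))
    {R : Scheme.{u}} [Nonempty R] (i : R ⟶ X) (hi : IsImmersion i)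
    (hfin : IsFinite (i ≫ f)) :
    ∃ (T : Scheme.{u}) (g : T ⟶ Spec (.of k)) (o : T) (F : MovingSchemes.FlatFamily f g),
      MovingSchemes.IsCurve g ∧
      MovingSchemes.IsKPoint g o ∧
      IsFinite F.proj ∧
      (∃ e : F.fibre o ≅ R, e.hom ≫ i = F.fibreToX o) ∧
      ∀ t : T, t ≠ o → Set.range (F.fibreToX t) ⊆ (U : Set X) := by
  have := hqp.isSeparated
  have := MovingSchemes.surjective_of_nonempty (i ≫ f)
  obtain ⟨N₀, ⟨m₀⟩⟩ := MovingSchemes.exists_move f U hU (i ≫ f) i rfl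
  obtain ⟨r, hr, hmono⟩ := m₀.exists_mono_incl
  -- A single shrinking makes the base integral, inverts `r` so that the family embeds, and leaves
  -- the base point as the only possible zero of the polynomial.
  obtain ⟨N, a, _, hu, hN⟩ := N₀.exists_shrink r hr m₀.poly m₀.poly_ne_zero
  have := hmono N a hu
  let m := m₀.restrict a
  refine ⟨N.scheme, N.toSpec, N.zeroPt, m.family, N.isCurve, N.isKPoint, m.isFinite_family_proj,
    m.exists_fibre_zero_iso, fun t ht ↦ m.range_fibreToX_subset t fun hmem ↦ ht ?_⟩
  exact PrimeSpectrum.ext (hN t.asIdeal t.isPrime hmem)
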